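/- **Proposition 5.5.** Let $D\subset\mathbb R^d$, $d\ge 1$, be a bounded open set (for instance a bounded Lipschitz domain with $d\in\{1,2,3\}$), let $V=H^1_0(D)$ (real-valued functions), $f\in V^*$, $o_1,\dots,o_K\in V^*$, let $\Gamma\in\mathbb R^{K\times K}$ be symmetric positive definite and $\delta\in\mathbb R^K$. Let $\mathbb J$ be a finite or countably infinite index set, $\bar a\in L^\infty(D)$ and $\psi_j\in L^\infty(D)$ for $j\in\mathbb J$ (real-valued), and for $y\in U=[-1,1]^{\mathbb J}$ put $u(\cdot,y)=\bar a+\sum_{j\in\mathbb J}y_j\psi_j$. Assume: 1. (uniform ellipticity) there are $0<a_{\min}\le a_{\max}<\infty$ such that for every $y\in U$, $a_{\min}\le u(x,y)\le a_{\max}$ for a.e. $x\in D$; 2. there are $\kappa>0$ and $\bar a_{\min}>0$ such that $\bar a(x)\ge\bar a_{\min}$ for a.e. $x\in D$ and $\sum_{j\in\mathbb J}\|\psi_j\|_{L^\infty(D)}\le\frac{\kappa}{1+\kappa}\,\bar a_{\min}$; 3. $0<\sigma<1$ and $\sum_{j\in\mathbb J}\|\psi_j\|_{L^\infty(D)}^\sigma<\infty$.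 Then for every $y\in U$ there is a unique weak solution $p(y)\in V$ of $-\nabla\cdot(u(\cdot,y)\nabla p(y))=f$ in $D$, $p(y)=0$ on $\partial D$, i.e. $\int_D u(x,y)\,\nabla p(y)\cdot\nabla q\,dx=f(q)$ for all $q\in V$. With $\mathcal G(y)=(o_k(p(y)))_{k=1}^K$, define the (unnormalized) posterior density $$\Theta(y)=\exp\Bigl(-\tfrac12(\delta-\mathcal G(y))^\top\Gamma^{-1}(\delta-\mathcal G(y))\Bigr),\qquad y\in U.$$ Then $\Theta$ is infinitely differentiable at $y=0$ in any finite number of the variables $y_j$ (the other variables being zero), and its Taylor coefficients $$\tau_\nu=\frac1{\nu!}\,\partial_y^\nu\Theta(y)\Big|_{y=0},\qquad \nu\in\mathcal F=\{\nu\in\mathbb N_0^{\mathbb J}:|\nu|_1<\infty\},$$ satisfy $(\tau_\nu)_{\nu\in\mathcal F}\in\ell^\sigma(\mathcal F)$, i.e. $\sum_{\nu\in\mathcal F}|\tau_\nu|^\sigma<\infty$. -/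

import Mathlib

open MeasureTheory
open scoped ENNReal ContDiff InnerProductSpace

noncomputable section

namespace EllipticInverse

/-- Lebesgue measure on `D ⊆ ℝ^d`. -/
abbrev dom {d : ℕ} (D : Set (EuclideanSpace ℝ (Fin d))) : Measure (EuclideanSpace ℝ (Fin d)) :=
  volume.restrict D

/-- The Banach space `X = L^∞(D)` of diffusion coefficients. -/
abbrev Linfty {d : ℕ} (D : Set (EuclideanSpace ℝ (Fin d))) : Type :=
  Lp ℝ ∞ (dom D)

/-- The Hilbert space `L²(D) × L²(D; ℝ^d)` with the norm `(‖v‖² + ‖g‖²)^{1/2}`. -/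
abbrev L2Pair {d : ℕ} (D : Set (EuclideanSpace ℝ (Fin d))) : Type :=
  WithLp 2 (Lp ℝ 2 (dom D) × Lp (EuclideanSpace ℝ (Fin d)) 2 (dom D))

/-- The linear space of all pairs `(φ, ∇φ)` with `φ ∈ C_c^∞(D)`. -/
def testPairs {d : ℕ} (D : Set (EuclideanSpace ℝ (Fin d))) : Submodule ℝ (L2Pair D) where
  carrier := {w | ∃ φ : EuclideanSpace ℝ (Fin d) → ℝ,
    ContDiff ℝ ∞ φ ∧ HasCompactSupport φ ∧ tsupport φ ⊆ D ∧
      w.fst =ᵐ[dom D] φ ∧ w.snd =ᵐ[dom D] gradient φ}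
  zero_mem' := by
    refine ⟨0, contDiff_const, HasCompactSupport.zero, by simp [tsupport], ?_, ?_⟩
    · exact Lp.coeFn_zero _ _ _
    · have h : gradient (0 : EuclideanSpace ℝ (Fin d) → ℝ) = 0 := by
        funext x
        simp [gradient]
      rw [h]
      exact Lp.coeFn_zero _ _ _
  add_mem' := by
    rintro v w ⟨φ, hφ, hφc, hφD, hφ1, hφ2⟩ ⟨χ, hχ, hχc, hχD, hχ1, hχ2⟩
    refine ⟨φ + χ, hφ.add hχ, hφc.add hχc,
      (tsupport_add φ χ).trans (Set.union_subset hφD hχD), ?_, ?_⟩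
    · exact (Lp.coeFn_add _ _).trans (hφ1.add hχ1)
    · have h : gradient (φ + χ) = gradient φ + gradient χ := by
        funext x
        simp [gradient, fderiv_add (hφ.differentiable (by simp)).differentiableAt
          (hχ.differentiable (by simp)).differentiableAt]
      rw [h]
      exact (Lp.coeFn_add _ _).trans (hφ2.add hχ2)
  smul_mem' := by
    rintro c w ⟨φ, hφ, hφc, hφD, hφ1, hφ2⟩
    refine ⟨c • φ, contDiff_const.smul hφ, hφc.smul_left,
      (tsupport_smul_subset_right (fun _ => c) φ).trans hφD, ?_, ?_⟩
    · exact (Lp.coeFn_smul _ _).trans (hφ1.const_smul c)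
    · have h : gradient (c • φ) = c • gradient φ := by
        funext x
        simp [gradient, fderiv_const_smul (hφ.differentiable (by simp)).differentiableAt]
      rw [h]
      exact (Lp.coeFn_smul _ _).trans (hφ2.const_smul c)

/-- The Sobolev space `V = H¹₀(D)`: the closure of `C_c^∞(D)` in the `H¹`-norm, a function `v`
being recorded together with its weak gradient as the pair `(v, ∇v)`. On a bounded `D` the
norm `‖∇v‖_{L²}` is equivalent to the `H¹`-norm, so that both give the same dual space. -/
def H10 {d : ℕ} (D : Set (EuclideanSpace ℝ (Fin d))) : Submodule ℝ (L2Pair D) :=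
  (testPairs D).topologicalClosure

/-- The (weak) gradient of an element of `H¹₀(D)`. -/
def grad {d : ℕ} {D : Set (EuclideanSpace ℝ (Fin d))} (p : H10 D) :
    Lp (EuclideanSpace ℝ (Fin d)) 2 (dom D) :=
  (p : L2Pair D).snd

/-- `p ∈ H¹₀(D)` is a weak solution of `-∇·(u∇p) = f` in `D`, `p = 0` on `∂D`, for
`f ∈ V* = H⁻¹(D)`. -/
def IsWeakSolution {d : ℕ} {D : Set (EuclideanSpace ℝ (Fin d))} (f : H10 D →L[ℝ] ℝ)
    (u : Linfty D) (p : H10 D) : Prop :=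
  ∀ q : H10 D, ∫ x in D, u x * ⟪grad p x, grad q x⟫_ℝ = f q

open Classical in
/-- The forward map `G : X → V`: the weak solution of the problem with coefficient `u`
(and `0` for those `u` for which there is none). -/
def forwardMap {d : ℕ} {D : Set (EuclideanSpace ℝ (Fin d))} (f : H10 D →L[ℝ] ℝ)
    (u : Linfty D) : H10 D :=
  if h : ∃ p, IsWeakSolution f u p then h.choose else 0

/-- The least squares potential `Φ(u; δ) = ½ (δ - 𝒢(u))ᵀ Γ⁻¹ (δ - 𝒢(u))`, where
`𝒢(u) = (o_k(G(u)))_k`. -/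
def potential {d K : ℕ} {D : Set (EuclideanSpace ℝ (Fin d))} (f : H10 D →L[ℝ] ℝ)
    (o : Fin K → (H10 D →L[ℝ] ℝ)) (Γ : Matrix (Fin K) (Fin K) ℝ) (δ : Fin K → ℝ)
    (u : Linfty D) : ℝ :=
  let e : Fin K → ℝ := fun k => δ k - o k (forwardMap f u)
  (1 / 2) * (e ⬝ᵥ (Γ⁻¹.mulVec e))

/-- The affine coefficient `u(·, y) = ā + ∑_j y_j ψ_j`, as an element of `L^∞(D)`. -/
def coeff {ι : Type*} {d : ℕ} {D : Set (EuclideanSpace ℝ (Fin d))} (a : Linfty D)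
    (ψ : ι → Linfty D) (y : ι → ℝ) : Linfty D :=
  a + ∑' j, y j • ψ j

/-- The parameter domain `U = [-1, 1]^𝕁`. -/
def paramDomain (ι : Type*) : Set (ι → ℝ) :=
  {y | ∀ j, y j ∈ Set.Icc (-1 : ℝ) 1}

/-- The (unnormalized) posterior density `Θ(y) = exp(-Φ(u(·, y); δ))`. -/
def posteriorDensity {ι : Type*} {d K : ℕ} {D : Set (EuclideanSpace ℝ (Fin d))}
    (f : H10 D →L[ℝ] ℝ) (o : Fin K → (H10 D →L[ℝ] ℝ)) (Γ : Matrix (Fin K) (Fin K) ℝ)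
    (δ : Fin K → ℝ) (a : Linfty D) (ψ : ι → Linfty D) (y : ι → ℝ) : ℝ :=
  Real.exp (-potential f o Γ δ (coeff a ψ y))

open Classical in
/-- The partial derivative `∂F/∂y_j`. -/
def partialDeriv {ι : Type*} (j : ι) (F : (ι → ℝ) → ℝ) : (ι → ℝ) → ℝ :=
  fun y => deriv (fun t => F (Function.update y j t)) (y j)

/-- The mixed partial derivative `∂^ν F`, where `ν_j` derivatives are taken in `y_j` for each
`j` in the support of `ν` (for smooth `F` the order of the coordinates plays no role). -/
def mixedPartial {ι : Type*} (ν : ι →₀ ℕ) (F : (ι → ℝ) → ℝ) : (ι → ℝ) → ℝ :=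
  ν.support.toList.foldr (fun j H => (partialDeriv j)^[ν j] H) F

/-- The Taylor coefficient `τ_ν = (1 / ν!) ∂^ν F(0)`. -/
def taylorCoeff {ι : Type*} (F : (ι → ℝ) → ℝ) (ν : ι →₀ ℕ) : ℝ :=
  mixedPartial ν F 0 / (ν.prod fun _ n => (n.factorial : ℝ))

/-- `F` is infinitely differentiable at the origin in any finite number of its variables,
the other variables being set to zero. -/
def SmoothAtZero {ι : Type*} (F : (ι → ℝ) → ℝ) : Prop :=
  ∀ S : Finset ι,
    ContDiffAt ℝ ∞ (fun t : S → ℝ => F (Function.extend Subtype.val t 0)) 0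

end EllipticInverse

end

/-! By the Poincaré inequality, `∇` identifies `H10 D` with a closed subspace `S` of `L²(D; ℝ^d)`.
There the equation reads `T u (e p) = F`, where `T u` is the compression of multiplication by `u`,
with `‖T u‖ ≤ ‖u‖` and coercivity constant any lower bound of `u`. Lax–Milgram gives well-posedness,
and smoothness of operator inversion gives smoothness of `Θ` at `0`.

For summability, put `C_j = T(a)⁻¹ T(ψ_j)`. Then `e p(y) = (1 + ∑ y_j C_j)⁻¹ T(a)⁻¹ F` with `‖C_j‖ ≤
b_j = ‖ψ_j‖ / abarmin` and `∑ b_j < 1`. The strict gap leaves room for weights `R_j > 1` with `∑ R_j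
b_j < 1` and `∑ R_j ^ (-σ/(1-σ)) < ∞` (`exists_weights`). The Neumann series, sorted by monomials,
satisfies `∑ ‖c_ν‖ R^ν < ∞` (`HasMonomialExpansion.neumann`). This property survives bounded linear
maps, products and `exp`, hence passes to `Θ`; no complex extension or Cauchy estimate is needed.

The coefficients are the Taylor coefficients by termwise differentiation. Hölder's inequality then
trades the weight for the exponent `σ` (`summable_rpow_of_weighted`), because `∑_ν R^(-νσ/(1-σ))` is
dominated by a convergent product of geometric series. -/

namespace EllipticInverse

/-! ### Monomials and absolutely convergent power series -/

section Expansion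

variable {ι : Type*} {E G : Type*} [NormedAddCommGroup E] [NormedSpace ℝ E]
  [NormedAddCommGroup G] [NormedSpace ℝ G]

/-- The monomial `x^ν`. -/
def mono (x : ι → ℝ) (ν : ι →₀ ℕ) : ℝ := ν.prod fun j n => x j ^ n

@[simp] theorem mono_zero_right (x : ι → ℝ) : mono x 0 = 1 := by simp [mono]

theorem mono_add (x : ι → ℝ) (μ ν : ι →₀ ℕ) : mono x (μ + ν) = mono x μ * mono x ν := by
  classical
  exact Finsupp.prod_add_index' (by simp) (fun _ _ _ => pow_add _ _ _)

@[simp] theorem mono_single (x : ι → ℝ) (j : ι) (n : ℕ) :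
    mono x (Finsupp.single j n) = x j ^ n := by
  simp [mono]

theorem abs_mono (x : ι → ℝ) (ν : ι →₀ ℕ) : |mono x ν| = mono (fun j => |x j|) ν := by
  simp [mono, Finsupp.prod, Finset.abs_prod, abs_pow]

theorem mono_nonneg {x : ι → ℝ} (hx : ∀ j, 0 ≤ x j) (ν : ι →₀ ℕ) : 0 ≤ mono x ν :=
  Finset.prod_nonneg fun j _ => pow_nonneg (hx j) _

theorem mono_pos {x : ι → ℝ} (hx : ∀ j, 0 < x j) (ν : ι →₀ ℕ) : 0 < mono x ν :=
  Finset.prod_pos fun j _ => pow_pos (hx j) _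

theorem mono_le_mono {x y : ι → ℝ} (hx : ∀ j, 0 ≤ x j) (hxy : ∀ j, x j ≤ y j) (ν : ι →₀ ℕ) :
    mono x ν ≤ mono y ν :=
  Finset.prod_le_prod (fun j _ => pow_nonneg (hx j) _)
    fun j _ => pow_le_pow_left₀ (hx j) (hxy j) _

theorem abs_mono_le {R : ι → ℝ} (hR : ∀ j, 1 ≤ R j) {y : ι → ℝ} (hy : y ∈ paramDomain ι)
    (ν : ι →₀ ℕ) : |mono y ν| ≤ mono R ν := by
  rw [abs_mono]
  exact mono_le_mono (fun j => abs_nonneg _) (fun j => (abs_le.2 (hy j)).trans (hR j)) ν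

/-- On `[-1, 1]^ι` the function `F` is given by a power series `∑ c_ν y^ν` with
`∑ ‖c_ν‖ R^ν ≤ M`. -/
def HasMonomialExpansion (R : ι → ℝ) (M : ℝ) (F : (ι → ℝ) → E) : Prop :=
  ∃ c : (ι →₀ ℕ) → E, Summable (fun ν => ‖c ν‖ * mono R ν) ∧ ∑' ν, ‖c ν‖ * mono R ν ≤ M ∧
    ∀ y ∈ paramDomain ι, HasSum (fun ν => mono y ν • c ν) (F y)

namespace HasMonomialExpansion

variable {R : ι → ℝ} {M N : ℝ} {F : (ι → ℝ) → E}

theorem congr (h : HasMonomialExpansion R M F) {F' : (ι → ℝ) → E}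
    (hF : ∀ y ∈ paramDomain ι, F y = F' y) : HasMonomialExpansion R M F' := by
  obtain ⟨c, h1, h2, h3⟩ := h
  exact ⟨c, h1, h2, fun y hy => hF y hy ▸ h3 y hy⟩

theorem bound_nonneg (hR : ∀ j, 1 ≤ R j) (h : HasMonomialExpansion R M F) : 0 ≤ M := by
  obtain ⟨c, -, h2, -⟩ := h
  exact (tsum_nonneg fun ν => mul_nonneg (norm_nonneg _)
    (mono_nonneg (fun j => zero_le_one.trans (hR j)) ν)).trans h2

theorem const (R : ι → ℝ) (v : E) : HasMonomialExpansion R ‖v‖ (fun _ => v) := by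
  classical
  have h : HasSum (fun ν : ι →₀ ℕ => ‖(Pi.single 0 v : (ι →₀ ℕ) → E) ν‖ * mono R ν) ‖v‖ := by
    simpa using hasSum_single (f := fun ν : ι →₀ ℕ =>
      ‖(Pi.single 0 v : (ι →₀ ℕ) → E) ν‖ * mono R ν) 0 (fun ν hν => by simp [hν])
  refine ⟨Pi.single 0 v, h.summable, h.tsum_eq.le, fun y _ => ?_⟩
  simpa using hasSum_single (f := fun ν : ι →₀ ℕ =>
    mono y ν • (Pi.single 0 v : (ι →₀ ℕ) → E) ν) 0 (fun ν hν => by simp [hν])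

theorem clm_apply (h : HasMonomialExpansion R M F) (hR : ∀ j, 1 ≤ R j) (L : E →L[ℝ] G) :
    HasMonomialExpansion R (‖L‖ * M) (fun y => L (F y)) := by
  obtain ⟨c, h1, h2, h3⟩ := h
  have hle : ∀ ν, ‖L (c ν)‖ * mono R ν ≤ ‖L‖ * (‖c ν‖ * mono R ν) := fun ν => by
    rw [← mul_assoc]
    exact mul_le_mul_of_nonneg_right (L.le_opNorm _)
      (mono_nonneg (fun j => zero_le_one.trans (hR j)) ν)
  have hs := h1.mul_left ‖L‖
  have hs' : Summable fun ν => ‖L (c ν)‖ * mono R ν :=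
    Summable.of_nonneg_of_le (fun ν => mul_nonneg (norm_nonneg _)
      (mono_nonneg (fun j => zero_le_one.trans (hR j)) ν)) hle hs
  refine ⟨fun ν => L (c ν), hs', ?_, fun y hy => ?_⟩
  · calc ∑' ν, ‖L (c ν)‖ * mono R ν ≤ ∑' ν, ‖L‖ * (‖c ν‖ * mono R ν) :=
          hs'.tsum_le_tsum hle hs
      _ = ‖L‖ * ∑' ν, ‖c ν‖ * mono R ν := tsum_mul_left
      _ ≤ _ := mul_le_mul_of_nonneg_left h2 (norm_nonneg _)
  · simpa using (h3 y hy).mapL L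

theorem of_le (h : HasMonomialExpansion R M F) (hMN : M ≤ N) : HasMonomialExpansion R N F := by
  obtain ⟨c, h1, h2, h3⟩ := h
  exact ⟨c, h1, h2.trans hMN, h3⟩

theorem const_smul (h : HasMonomialExpansion R M F) (hR : ∀ j, 1 ≤ R j) (a : ℝ) :
    HasMonomialExpansion R (|a| * M) (fun y => a • F y) := by
  refine (h.clm_apply hR (a • ContinuousLinearMap.id ℝ E)).of_le ?_
  refine mul_le_mul_of_nonneg_right ?_ (h.bound_nonneg hR)
  rw [norm_smul]
  exact mul_le_of_le_one_right (norm_nonneg _) ContinuousLinearMap.norm_id_le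

/-- Multiplying by `y^μ` shifts the coefficients by `μ`. As `R^(ν+μ) = R^ν R^μ`, the weighted norm
grows by exactly `R^μ`. -/
theorem mono_smul (h : HasMonomialExpansion R M F) (hR : ∀ j, 1 ≤ R j) (μ : ι →₀ ℕ) :
    HasMonomialExpansion R (mono R μ * M) (fun y => mono y μ • F y) := by
  classical
  obtain ⟨c, h1, h2, h3⟩ := h
  have hinj : Function.Injective (fun ν : ι →₀ ℕ => ν + μ) := add_left_injective μ
  set c' : (ι →₀ ℕ) → E := Function.extend (fun ν => ν + μ) c 0 with hc'
  have hc1 : ∀ ν, c' (ν + μ) = c ν := fun ν => hinj.extend_apply c 0 ν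
  have hc2 : ∀ ν, ν ∉ Set.range (fun ν : ι →₀ ℕ => ν + μ) → c' ν = 0 := fun ν hν => by
    rw [hc', Function.extend_apply' _ _ _ (by simpa using hν)]
    rfl
  have key : HasSum (fun ν => ‖c' ν‖ * mono R ν) (mono R μ * ∑' ν, ‖c ν‖ * mono R ν) := by
    rw [← hinj.hasSum_iff (fun ν hν => by rw [hc2 ν hν]; simp)]
    convert! h1.hasSum.mul_left (mono R μ) using 1
    funext ν
    simp only [Function.comp, hc1, mono_add]
    ring
  refine ⟨c', key.summable, ?_, fun y hy => ?_⟩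
  · rw [key.tsum_eq]
    exact mul_le_mul_of_nonneg_left h2 (mono_nonneg (fun j => zero_le_one.trans (hR j)) μ)
  · rw [← hinj.hasSum_iff (fun ν hν => by rw [hc2 ν hν]; simp)]
    convert! (h3 y hy).const_smul (mono y μ) using 1
    funext ν
    simp only [Function.comp, hc1, mono_add, smul_smul]
    rw [mul_comm]

/-- Fubini: summable bounds make the double family of coefficients absolutely summable, so it may be
regrouped by `ν`. Since `R ≥ 1`, the weighted sum dominates both the plain norms and the terms at
every point of the cube. Sums, products, `exp` and Neumann series all reduce to this. -/
theorem hasSum [CompleteSpace E] (hR : ∀ j, 1 ≤ R j) {κ : Type*} {F : κ → (ι → ℝ) → E}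
    {M : κ → ℝ} {H : (ι → ℝ) → E}
    (h : ∀ k, HasMonomialExpansion R (M k) (F k)) (hM : Summable M)
    (hH : ∀ y ∈ paramDomain ι, HasSum (fun k => F k y) (H y)) :
    HasMonomialExpansion R (∑' k, M k) H := by
  choose c h1 h2 h3 using h
  have hRn : ∀ ν, 0 ≤ mono R ν := mono_nonneg (fun j => zero_le_one.trans (hR j))
  have hRone : ∀ ν, 1 ≤ mono R ν := fun ν => by
    simpa [mono] using mono_le_mono (x := fun _ : ι => (1 : ℝ)) (fun _ => zero_le_one) hR ν
  have hnn : ∀ k ν, 0 ≤ ‖c k ν‖ * mono R ν := fun k ν => mul_nonneg (norm_nonneg _) (hRn ν)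
  have hS : Summable fun p : κ × (ι →₀ ℕ) => ‖c p.1 p.2‖ * mono R p.2 := by
    rw [summable_prod_of_nonneg (fun p => hnn _ _)]
    exact ⟨h1, Summable.of_nonneg_of_le (fun k => tsum_nonneg (hnn k)) h2 hM⟩
  have hS2 : Summable fun p : κ × (ι →₀ ℕ) => c p.1 p.2 := by
    refine Summable.of_norm_bounded hS fun p => ?_
    exact le_mul_of_one_le_right (norm_nonneg _) (hRone _)
  have hSs : Summable fun p : (ι →₀ ℕ) × κ => ‖c p.2 p.1‖ * mono R p.1 :=
    (Equiv.prodComm _ _).summable_iff.2 hS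
  have hSn : Summable fun p : (ι →₀ ℕ) × κ => ‖c p.2 p.1‖ :=
    Summable.of_nonneg_of_le (fun _ => norm_nonneg _)
      (fun p => le_mul_of_one_le_right (norm_nonneg _) (hRone _)) hSs
  have hSk : ∀ ν, Summable fun k => ‖c k ν‖ := fun ν => hSn.prod_factor ν
  have hle : ∀ ν, ‖∑' k, c k ν‖ * mono R ν ≤ ∑' k, ‖c k ν‖ * mono R ν := fun ν => by
    rw [tsum_mul_right]
    exact mul_le_mul_of_nonneg_right (norm_tsum_le_tsum_norm (hSk ν)) (hRn ν)
  have hSs' : Summable fun ν => ∑' k, ‖c k ν‖ * mono R ν := hSs.prod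
  have hd : Summable fun ν => ‖∑' k, c k ν‖ * mono R ν :=
    Summable.of_nonneg_of_le (fun ν => mul_nonneg (norm_nonneg _) (hRn ν)) hle hSs'
  refine ⟨fun ν => ∑' k, c k ν, hd, ?_, fun y hy => ?_⟩
  · calc _ ≤ ∑' ν, ∑' k, ‖c k ν‖ * mono R ν := hd.tsum_le_tsum hle hSs'
      _ = ∑' k, ∑' ν, ‖c k ν‖ * mono R ν :=
        Summable.tsum_comm (f := fun k ν => ‖c k ν‖ * mono R ν) hS
      _ ≤ _ := hS.prod.tsum_le_tsum h2 hM
  · have hT : Summable fun p : κ × (ι →₀ ℕ) => mono y p.2 • c p.1 p.2 := by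
      refine Summable.of_norm_bounded hS fun p => ?_
      rw [norm_smul, mul_comm]
      exact mul_le_mul_of_nonneg_left (abs_mono_le hR hy _) (norm_nonneg _)
    have e1 : ∑' p : κ × (ι →₀ ℕ), mono y p.2 • c p.1 p.2 = H y :=
      (hT.hasSum.prod_fiberwise fun k => h3 k y hy).unique (hH y hy)
    have hT' : HasSum (fun p : (ι →₀ ℕ) × κ => mono y p.1 • c p.2 p.1) (H y) := by
      rw [← (Equiv.prodComm κ (ι →₀ ℕ)).hasSum_iff, ← e1]
      exact hT.hasSum
    refine hT'.prod_fiberwise fun ν => ?_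
    exact ((hSk ν).of_norm.hasSum).const_smul (mono y ν)

theorem add [CompleteSpace E] (hR : ∀ j, 1 ≤ R j) {F' : (ι → ℝ) → E}
    (h : HasMonomialExpansion R M F) (h' : HasMonomialExpansion R N F') :
    HasMonomialExpansion R (M + N) (fun y => F y + F' y) := by
  have := HasMonomialExpansion.hasSum hR (κ := Bool) (F := fun b => bif b then F else F')
    (M := fun b => bif b then M else N) (H := fun y => F y + F' y)
    (by rintro (_ | _) <;> assumption) (Summable.of_finite) (fun y _ => by
      simpa [Fintype.sum_bool] using
        hasSum_fintype (fun b : Bool => (bif b then F else F') y))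
  simpa [tsum_fintype] using this

theorem sum [CompleteSpace E] (hR : ∀ j, 1 ≤ R j) {κ : Type*} (s : Finset κ)
    {F : κ → (ι → ℝ) → E} {M : κ → ℝ} (h : ∀ k, HasMonomialExpansion R (M k) (F k)) :
    HasMonomialExpansion R (∑ k ∈ s, M k) (fun y => ∑ k ∈ s, F k y) := by
  classical
  induction s using Finset.induction_on with
  | empty => simpa using const R (0 : E)
  | insert k s hk ih =>
    simp only [Finset.sum_insert hk]
    exact (h k).add hR ih

/-- Write `f F = ∑_μ c_μ (y^μ F)`; each term is a shift of the expansion of `F`, of weighted norm at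
most `|c_μ| R^μ N`. -/
theorem smul [CompleteSpace E] (hR : ∀ j, 1 ≤ R j) {f : (ι → ℝ) → ℝ}
    (hf : HasMonomialExpansion R M f) (h : HasMonomialExpansion R N F) :
    HasMonomialExpansion R (M * N) (fun y => f y • F y) := by
  obtain ⟨c, h1, h2, h3⟩ := hf
  have key := HasMonomialExpansion.hasSum hR
    (fun μ => (h.mono_smul hR μ).const_smul hR (c μ))
    (H := fun y => f y • F y) ?_ ?_
  · refine key.of_le ?_
    rw [tsum_congr fun μ => (mul_assoc |c μ| (mono R μ) N).symm, tsum_mul_right]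
    exact mul_le_mul_of_nonneg_right h2 (h.bound_nonneg hR)
  · simpa only [mul_assoc, Real.norm_eq_abs] using h1.mul_right N
  · intro y hy
    convert! (h3 y hy).smul_const (F y) using 1
    funext ν
    simp [smul_smul, mul_comm]

theorem mul (hR : ∀ j, 1 ≤ R j) {f g : (ι → ℝ) → ℝ}
    (hf : HasMonomialExpansion R M f) (hg : HasMonomialExpansion R N g) :
    HasMonomialExpansion R (M * N) (fun y => f y * g y) :=
  hf.smul hR hg

theorem pow (hR : ∀ j, 1 ≤ R j) {f : (ι → ℝ) → ℝ} (hf : HasMonomialExpansion R M f) (n : ℕ) :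
    HasMonomialExpansion R (M ^ n) (fun y => f y ^ n) := by
  induction n with
  | zero => simpa using const R (1 : ℝ)
  | succ n ih => simpa only [pow_succ] using ih.mul hR hf

theorem exp (hR : ∀ j, 1 ≤ R j) {f : (ι → ℝ) → ℝ} (hf : HasMonomialExpansion R M f) :
    ∃ N, HasMonomialExpansion R N (fun y => Real.exp (f y)) := by
  refine ⟨_, HasMonomialExpansion.hasSum hR (H := fun y => Real.exp (f y))
    (fun n : ℕ => (hf.pow hR n).const_smul hR ((n.factorial : ℝ)⁻¹)) ?_ ?_⟩
  · refine (Real.summable_pow_div_factorial M).congr fun n => ?_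
    rw [abs_of_nonneg (by positivity), div_eq_inv_mul]
  · intro y _
    rw [Real.exp_eq_exp_ℝ]
    refine (NormedSpace.expSeries_div_hasSum_exp (f y)).congr_fun fun n => ?_
    rw [smul_eq_mul, div_eq_inv_mul]

/-- With `K = -∑ y_j C_j`, one has `K^(n+1) v = ∑_j y_j (-C_j) (K^n v)`, so each power costs a
factor `θ = ∑ R_j ‖C_j‖ < 1` in the weighted norm. The coefficients, sums over words in the
noncommuting `C_j`, never have to be written down. -/
theorem neumann [CompleteSpace E] (hR : ∀ j, 1 ≤ R j) {C : ι → E →L[ℝ] E}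
    (hC : Summable fun j => R j * ‖C j‖) (hC1 : ∑' j, R j * ‖C j‖ < 1) (v : E) :
    ∃ N, HasMonomialExpansion R N
      (fun y => ∑' n : ℕ, ((-∑' j, y j • C j) ^ n) v) := by
  have hCn : Summable fun j => ‖C j‖ := Summable.of_nonneg_of_le (fun _ => norm_nonneg _)
    (fun j => le_mul_of_one_le_left (norm_nonneg _) (hR j)) hC
  have hle : ∀ y ∈ paramDomain ι, ∀ j, ‖y j • C j‖ ≤ ‖C j‖ := fun y hy j => by
    rw [norm_smul]
    exact mul_le_of_le_one_left (norm_nonneg _) (abs_le.2 (hy j))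
  have hyC : ∀ y ∈ paramDomain ι, Summable fun j => y j • C j := fun y hy =>
    Summable.of_norm_bounded hCn (hle y hy)
  set θ := ∑' j, R j * ‖C j‖ with hθ
  have hθ0 : 0 ≤ θ := tsum_nonneg fun j =>
    mul_nonneg (zero_le_one.trans (hR j)) (norm_nonneg _)
  have hpow : ∀ n : ℕ, HasMonomialExpansion R (θ ^ n * ‖v‖)
      (fun y => ((-∑' j, y j • C j) ^ n) v) := by
    intro n
    induction n with
    | zero => simpa using const R v
    | succ n ih =>
      have := HasMonomialExpansion.hasSum hR
        (fun j => (ih.clm_apply hR (-C j)).mono_smul hR (Finsupp.single j 1))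
        (H := fun y => ((-∑' j, y j • C j) ^ (n + 1)) v) ?_ ?_
      · refine this.of_le (le_of_eq ?_)
        simp only [mono_single, pow_one, norm_neg, ← mul_assoc]
        rw [tsum_mul_right, tsum_mul_right, ← hθ, pow_succ']
      · simp only [mono_single, pow_one, norm_neg, ← mul_assoc]
        exact (hC.mul_right _).mul_right _
      · intro y hy
        have h := ((hyC y hy).hasSum.neg).mapL
          (ContinuousLinearMap.apply ℝ E (((-∑' j, y j • C j) ^ n) v))
        simpa [pow_succ'] using h
  have hgeo : ∀ y ∈ paramDomain ι,
      HasSum (fun n : ℕ => ((-∑' j, y j • C j) ^ n) v) (∑' n : ℕ, ((-∑' j, y j • C j) ^ n) v) := by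
    intro y hy
    have hlt : ‖-∑' j, y j • C j‖ < 1 := by
      rw [norm_neg]
      refine ((tsum_of_norm_bounded hC.hasSum fun j => ?_)).trans_lt hC1
      exact (hle y hy j).trans (le_mul_of_one_le_left (norm_nonneg _) (hR j))
    have h := ((summable_geometric_of_norm_lt_one hlt).hasSum).mapL
      (ContinuousLinearMap.apply ℝ E v)
    exact h.summable.hasSum
  exact ⟨_, HasMonomialExpansion.hasSum hR hpow
    ((summable_geometric_of_lt_one hθ0 hC1).mul_right _) hgeo⟩

end HasMonomialExpansion

end Expansion

end EllipticInverse

namespace EllipticInverse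

/-! ### Termwise differentiation and Taylor coefficients -/

section Taylor

variable {ι : Type*}

/-- The multi-index factorial `ν!`. -/
def multiFactorial (ν : ι →₀ ℕ) : ℝ := ν.prod fun _ n => (n.factorial : ℝ)

theorem multiFactorial_ne_zero (ν : ι →₀ ℕ) : multiFactorial ν ≠ 0 :=
  Finset.prod_ne_zero_iff.2 fun _ _ => by positivity

theorem multiFactorial_add_single (ν : ι →₀ ℕ) (j : ι) :
    multiFactorial (ν + Finsupp.single j 1) = (ν j + 1) * multiFactorial ν := by
  classical
  set S := insert j ν.support
  have hj : j ∈ S := Finset.mem_insert_self _ _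
  have h1 : ν.support ⊆ S := Finset.subset_insert _ _
  have h2 : (ν + Finsupp.single j 1).support ⊆ S := by
    refine Finsupp.support_add.trans (Finset.union_subset h1 ?_)
    exact Finsupp.support_single_subset.trans (by simpa using hj)
  rw [multiFactorial, multiFactorial, Finsupp.prod_of_support_subset _ h1 _ (by simp),
    Finsupp.prod_of_support_subset _ h2 _ (by simp), ← Finset.mul_prod_erase S _ hj,
    ← Finset.mul_prod_erase S _ hj, ← mul_assoc]
  congr 1
  · simp [Nat.factorial_succ]
  · refine Finset.prod_congr rfl fun i hi => ?_
    simp [(Finset.ne_of_mem_erase hi).symm]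

open Classical in
-- Isolates the dependence on one variable: the value `1` in slot `j` removes that variable from the
-- monomial.
theorem mono_update (y : ι → ℝ) (j : ι) (t : ℝ) (ν : ι →₀ ℕ) :
    mono (Function.update y j t) ν = t ^ ν j * mono (Function.update y j 1) ν := by
  have h1 : ν.support ⊆ insert j ν.support := Finset.subset_insert _ _
  have hj : j ∈ insert j ν.support := Finset.mem_insert_self _ _
  rw [mono, mono, Finsupp.prod_of_support_subset _ h1 _ (by simp),
    Finsupp.prod_of_support_subset _ h1 _ (by simp), ← Finset.mul_prod_erase _ _ hj,
    ← Finset.mul_prod_erase _ _ hj]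
  simp only [Function.update_self, one_pow, one_mul]
  congr 1
  refine Finset.prod_congr rfl fun i hi => ?_
  simp [Finset.ne_of_mem_erase hi]

/-- `r^(n+1) - s^(n+1)` is `r - s` times a sum of `n + 1` products, each at least `s^n`. This lets
the series at `r` dominate the differentiated series on `|t| < s`. -/
theorem succ_mul_pow_mul_sub_le {s r : ℝ} (hs : 0 ≤ s) (hsr : s ≤ r) (n : ℕ) :
    (n + 1) * s ^ n * (r - s) ≤ r ^ (n + 1) - s ^ (n + 1) := by
  induction n with
  | zero => simp
  | succ n ih =>
    have h1 : s * ((n + 1) * s ^ n * (r - s)) ≤ r * (r ^ (n + 1) - s ^ (n + 1)) :=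
      mul_le_mul hsr ih (by have := sub_nonneg.2 hsr; positivity) (hs.trans hsr)
    have h2 : ((n + 1 : ℕ) + 1 : ℝ) * s ^ (n + 1) * (r - s)
        = s * ((n + 1) * s ^ n * (r - s)) + s ^ (n + 1) * (r - s) := by
      push_cast; ring
    rw [h2]
    calc _ ≤ r * (r ^ (n + 1) - s ^ (n + 1)) + s ^ (n + 1) * (r - s) := by gcongr
      _ = _ := by ring

theorem natCast_mul_pow_pred_le {s r : ℝ} (hs : 0 ≤ s) (hsr : s < r) (n : ℕ) :
    n * s ^ (n - 1) ≤ (r - s)⁻¹ * r ^ n := by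
  have hrs : 0 < r - s := sub_pos.2 hsr
  rw [← div_eq_inv_mul, le_div_iff₀ hrs]
  cases n with
  | zero => simp
  | succ n =>
    have := succ_mul_pow_mul_sub_le hs hsr.le n
    have h2 : 0 ≤ s ^ (n + 1) := by positivity
    push_cast
    linarith

theorem abs_mul_natCast_mul_pow_pred_le {s r t : ℝ} (hsr : s < r) (ht : |t| < s) (a : ℝ)
    (n : ℕ) : |a * (n * t ^ (n - 1))| ≤ (r - s)⁻¹ * |a * r ^ n| := by
  have hs0 : 0 ≤ s := (abs_nonneg _).trans ht.le
  have h1 : (n : ℝ) * |t| ^ (n - 1) ≤ n * s ^ (n - 1) := by gcongr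
  rw [abs_mul, abs_mul, abs_mul, abs_pow, abs_pow, Nat.abs_cast,
    abs_of_nonneg (hs0.trans hsr.le), mul_left_comm _ |a| (r ^ n)]
  exact mul_le_mul_of_nonneg_left (h1.trans (natCast_mul_pow_pred_le hs0 hsr _)) (abs_nonneg _)

/-- On the open cube `(-1, 1)^ι` the function `F` is the sum of `∑ e_ν / ν! y^ν`. -/
def HasTaylorSeries (F : (ι → ℝ) → ℝ) (e : (ι →₀ ℕ) → ℝ) : Prop :=
  ∀ y : ι → ℝ, (∀ j, |y j| < 1) → HasSum (fun ν => e ν / multiFactorial ν * mono y ν) (F y)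

namespace HasTaylorSeries

variable {F : (ι → ℝ) → ℝ} {e : (ι →₀ ℕ) → ℝ}

/-- With the normalisation `e_ν / ν!`, differentiation is a pure shift of `e`. Choosing `|y_j| < s <
r < 1`, absolute convergence at `y_j = r` dominates the derivatives on `(-s, s)`. The conclusion
holds on the same open cube, so the lemma can be iterated. -/
theorem partialDeriv (h : HasTaylorSeries F e) (j : ι) :
    HasTaylorSeries (partialDeriv j F) (fun ν => e (ν + Finsupp.single j 1)) := by
  classical
  intro y hy
  obtain ⟨s, hys, hs1⟩ := exists_between (hy j)
  obtain ⟨r, hsr, hr1⟩ := exists_between hs1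
  have hs0 : 0 ≤ s := (abs_nonneg _).trans hys.le
  have hbox : ∀ t : ℝ, |t| < 1 → ∀ i, |Function.update y j t i| < 1 := fun t ht i => by
    rcases eq_or_ne i j with rfl | hij
    · simpa using ht
    · simpa [hij] using hy i
  set m : (ι →₀ ℕ) → ℝ := fun ν => e ν / multiFactorial ν * mono (Function.update y j 1) ν with hm
  have hterm : ∀ t ν, e ν / multiFactorial ν * mono (Function.update y j t) ν = m ν * t ^ ν j :=
    fun t ν => by rw [mono_update, hm]; ring
  have hsum : ∀ t : ℝ, |t| < 1 → HasSum (fun ν => m ν * t ^ ν j) (F (Function.update y j t)) :=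
    fun t ht => by simpa only [hterm] using h _ (hbox t ht)
  have hu : Summable fun ν => (r - s)⁻¹ * |m ν * r ^ ν j| :=
    ((hsum r (by rwa [abs_of_nonneg (hs0.trans hsr.le)])).summable.abs).mul_left _
  have hbd : ∀ ν, ∀ t ∈ Set.Ioo (-s) s,
      ‖m ν * (ν j * t ^ (ν j - 1))‖ ≤ (r - s)⁻¹ * |m ν * r ^ ν j| := by
    intro ν t ht
    exact abs_mul_natCast_mul_pow_pred_le hsr (abs_lt.2 ht) (m ν) (ν j)
  have hys' : y j ∈ Set.Ioo (-s) s := abs_lt.1 hys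
  have hderiv := hasDerivAt_tsum_of_isPreconnected hu isOpen_Ioo isPreconnected_Ioo
    (g := fun ν t => m ν * t ^ ν j) (fun ν t _ => (hasDerivAt_pow (ν j) t).const_mul (m ν)) hbd hys'
    (hsum _ (hy j)).summable hys'
  have hev : (fun t => F (Function.update y j t)) =ᶠ[nhds (y j)] fun t => ∑' ν, m ν * t ^ ν j := by
    filter_upwards [isOpen_Ioo.mem_nhds hys'] with t ht
    exact (hsum t ((abs_lt.2 ht).trans hs1)).tsum_eq.symm
  have hval : EllipticInverse.partialDeriv j F y = ∑' ν, m ν * (ν j * y j ^ (ν j - 1)) :=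
    (hderiv.congr_of_eventuallyEq hev).deriv
  have hS : HasSum (fun ν => m ν * (ν j * y j ^ (ν j - 1))) (EllipticInverse.partialDeriv j F y) := by
    rw [hval]
    exact (Summable.of_norm_bounded hu fun ν => hbd ν _ hys').hasSum
  -- Terms with `ν j = 0` have zero derivative, so the sum lives on the range of the shift.
  have hinj : Function.Injective fun ν : ι →₀ ℕ => ν + Finsupp.single j 1 := add_left_injective _
  rw [← hinj.hasSum_iff] at hS
  · refine hS.congr_fun fun ν => ?_
    have hy1 : mono y ν = y j ^ ν j * mono (Function.update y j 1) ν := by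
      rw [← mono_update, Function.update_eq_self]
    have := multiFactorial_ne_zero ν
    have h2 : (ν j + 1 : ℝ) ≠ 0 := by positivity
    simp only [Function.comp, hm, mono_add, mono_single, Function.update_self,
      multiFactorial_add_single, hy1, Finsupp.add_apply, Finsupp.single_eq_same, Nat.add_sub_cancel]
    push_cast
    field_simp
  · intro ν hν
    have : ν j = 0 := by
      by_contra h0
      refine hν ⟨ν - Finsupp.single j 1, ?_⟩
      exact tsub_add_cancel_of_le (by simpa [Nat.one_le_iff_ne_zero] using h0)
    simp [this]

theorem iterate_partialDeriv (h : HasTaylorSeries F e) (j : ι) (n : ℕ) :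
    HasTaylorSeries ((EllipticInverse.partialDeriv j)^[n] F)
      (fun ν => e (ν + Finsupp.single j n)) := by
  induction n with
  | zero => simpa using h
  | succ n ih =>
    rw [Function.iterate_succ_apply']
    convert! ih.partialDeriv j using 3
    rw [add_assoc, ← Finsupp.single_add, add_comm 1 n]

theorem foldr_partialDeriv (h : HasTaylorSeries F e) (μ : ι →₀ ℕ) (l : List ι) :
    HasTaylorSeries (l.foldr (fun j H => (EllipticInverse.partialDeriv j)^[μ j] H) F)
      (fun ν => e (ν + (l.map fun j => Finsupp.single j (μ j)).sum)) := by
  induction l with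
  | nil => simpa using h
  | cons j l ih =>
    convert! ih.iterate_partialDeriv j (μ j) using 3
    simp [add_assoc]

theorem apply_zero (h : HasTaylorSeries F e) : F 0 = e 0 := by
  refine (h 0 (by simp)).unique ?_
  have h0 : ∀ ν : ι →₀ ℕ, ν ≠ 0 → mono (0 : ι → ℝ) ν = 0 := fun ν hν => by
    obtain ⟨j, hj⟩ := Finsupp.support_nonempty_iff.2 hν
    exact Finset.prod_eq_zero hj (by simpa using hj)
  simpa [multiFactorial] using hasSum_single (f := fun ν : ι →₀ ℕ =>
    e ν / multiFactorial ν * mono 0 ν) 0 (fun ν hν => by simp [h0 ν hν])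

theorem taylorCoeff_eq (h : HasTaylorSeries F e) (ν : ι →₀ ℕ) :
    taylorCoeff F ν = e ν / multiFactorial ν := by
  have h1 := (h.foldr_partialDeriv ν ν.support.toList).apply_zero
  have h2 : (ν.support.toList.map fun j => Finsupp.single j (ν j)).sum = ν := by
    rw [Finset.sum_map_toList]
    exact ν.sum_single
  rw [h2, zero_add] at h1
  rw [taylorCoeff, mixedPartial, h1, multiFactorial]

end HasTaylorSeries

theorem HasMonomialExpansion.summable_taylorCoeff {R : ι → ℝ} {M : ℝ} {F : (ι → ℝ) → ℝ}
    (h : HasMonomialExpansion R M F) : Summable fun ν => |taylorCoeff F ν| * mono R ν := by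
  obtain ⟨c, h1, -, h3⟩ := h
  have hT : HasTaylorSeries F (fun ν => multiFactorial ν * c ν) := fun y hy => by
    refine (h3 y fun j => abs_le.1 (hy j).le).congr_fun fun ν => ?_
    rw [mul_div_cancel_left₀ _ (multiFactorial_ne_zero ν), smul_eq_mul, mul_comm]
  refine h1.congr fun ν => ?_
  rw [hT.taylorCoeff_eq, mul_div_cancel_left₀ _ (multiFactorial_ne_zero ν), Real.norm_eq_abs]

end Taylor

end EllipticInverse

namespace EllipticInverse

/-! ### Summability of monomials and of weighted sequences -/

section Summability

variable {ι : Type*}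

/-- Expanding the product yields each monomial supported in `S` with exponents below `N` exactly
once; the terms missing from `u` are nonnegative. -/
theorem sum_mono_le_prod_sum_range {t : ι → ℝ} (ht : ∀ j, 0 ≤ t j) {u : Finset (ι →₀ ℕ)}
    {S : Finset ι} {N : ℕ} (hS : ∀ ν ∈ u, ν.support ⊆ S) (hN : ∀ ν ∈ u, ∀ j, ν j < N) :
    ∑ ν ∈ u, mono t ν ≤ ∏ j ∈ S, ∑ n ∈ Finset.range N, t j ^ n := by
  classical
  have hinj : Set.InjOn (fun (ν : ι →₀ ℕ) (j : ι) (_ : j ∈ S) => ν j) u := by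
    intro ν hν μ hμ h
    ext j
    by_cases hj : j ∈ S
    · exact congrFun (congrFun h j) hj
    · rw [Finsupp.notMem_support_iff.1 fun h => hj (hS ν hν h),
        Finsupp.notMem_support_iff.1 fun h => hj (hS μ hμ h)]
  have hterm : ∀ ν ∈ u, mono t ν = ∏ x ∈ S.attach, t x.1 ^ ν x.1 := fun ν hν => by
    rw [mono, Finsupp.prod_of_support_subset ν (hS ν hν) _ (by simp),
      Finset.prod_attach S fun j => t j ^ ν j]
  rw [Finset.prod_sum S (fun _ => Finset.range N) fun j n => t j ^ n, Finset.sum_congr rfl hterm,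
    ← Finset.sum_image (f := fun p : (j : ι) → j ∈ S → ℕ => ∏ x ∈ S.attach, t x.1 ^ p x.1 x.2) hinj]
  refine Finset.sum_le_sum_of_subset_of_nonneg ?_ fun p _ _ =>
    Finset.prod_nonneg fun x _ => pow_nonneg (ht _) _
  intro p hp
  obtain ⟨ν, hν, rfl⟩ := Finset.mem_image.1 hp
  exact Finset.mem_pi.2 fun j _ => Finset.mem_range.2 (hN ν hν j)

theorem sum_mono_le_prod {t : ι → ℝ} (ht : ∀ j, 0 ≤ t j) (ht1 : ∀ j, t j < 1)
    (u : Finset (ι →₀ ℕ)) : ∃ S : Finset ι, ∑ ν ∈ u, mono t ν ≤ ∏ j ∈ S, (1 - t j)⁻¹ := by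
  classical
  obtain ⟨N, hN⟩ : ∃ N : ℕ, ∀ ν ∈ u, ∀ j, ν j < N := by
    refine ⟨(u.sup fun ν => ν.support.sup ν) + 1, fun ν hν j => Nat.lt_succ_of_le ?_⟩
    by_cases hj : ν j = 0
    · simp [hj]
    · exact (Finset.le_sup (f := ν) (Finsupp.mem_support_iff.2 hj)).trans
        (Finset.le_sup (f := fun ν : ι →₀ ℕ => ν.support.sup ν) hν)
  refine ⟨u.biUnion fun ν => ν.support, (sum_mono_le_prod_sum_range ht (fun ν hν =>
    Finset.subset_biUnion_of_mem (fun ν : ι →₀ ℕ => ν.support) hν) hN).trans ?_⟩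
  refine Finset.prod_le_prod
    (fun j _ => Finset.sum_nonneg fun n _ => pow_nonneg (ht j) n) fun j _ => ?_
  rw [← tsum_geometric_of_lt_one (ht j) (ht1 j)]
  exact (summable_geometric_of_lt_one (ht j) (ht1 j)).sum_le_tsum _ fun n _ => pow_nonneg (ht j) n

/-- Finite sums are at most finite products of `(1 - t_j)⁻¹ = 1 + t_j/(1 - t_j) ≤ exp (t_j/(1 -
t_j))`. The exponents are summable, being at most `2 t_j` as soon as `t_j ≤ 1/2`, which fails for
only finitely many `j`. -/
theorem summable_mono {t : ι → ℝ} (ht : ∀ j, 0 ≤ t j) (ht1 : ∀ j, t j < 1) (hs : Summable t) :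
    Summable (mono t) := by
  have hpos : ∀ j, 0 < 1 - t j := fun j => sub_pos.2 (ht1 j)
  have hq : Summable fun j => t j / (1 - t j) := by
    refine Summable.of_norm_bounded_eventually (hs.mul_left 2) ?_
    filter_upwards [hs.tendsto_cofinite_zero.eventually_le_const (show (0 : ℝ) < 1 / 2 by norm_num)]
      with j hj
    rw [Real.norm_of_nonneg (div_nonneg (ht j) (hpos j).le), div_le_iff₀ (hpos j)]
    nlinarith [ht j]
  refine summable_of_sum_le (fun ν => mono_nonneg ht ν)
    (c := Real.exp (∑' j, t j / (1 - t j))) fun u => ?_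
  obtain ⟨S, hS⟩ := sum_mono_le_prod ht ht1 u
  refine hS.trans ?_
  calc ∏ j ∈ S, (1 - t j)⁻¹ ≤ ∏ j ∈ S, Real.exp (t j / (1 - t j)) := by
        refine Finset.prod_le_prod (fun j _ => (inv_pos.2 (hpos j)).le) fun j _ => ?_
        refine le_trans (le_of_eq ?_) (Real.add_one_le_exp _)
        field_simp [(hpos j).ne']
        ring
    _ = Real.exp (∑ j ∈ S, t j / (1 - t j)) := (Real.exp_sum _ _).symm
    _ ≤ _ := Real.exp_le_exp.2 (hq.sum_le_tsum _ fun j _ => div_nonneg (ht j) (hpos j).le)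

theorem mono_rpow {R : ι → ℝ} (hR : ∀ j, 0 ≤ R j) (s : ℝ) (ν : ι →₀ ℕ) :
    mono (fun j => R j ^ s) ν = mono R ν ^ s := by
  rw [mono, mono, Finsupp.prod, Finsupp.prod, ← Real.finsetProd_rpow _ _
    (fun j _ => pow_nonneg (hR j) _)]
  refine Finset.prod_congr rfl fun j _ => ?_
  rw [← Real.rpow_natCast, ← Real.rpow_natCast, ← Real.rpow_mul (hR j), ← Real.rpow_mul (hR j),
    mul_comm]

/-- Hölder's inequality: a weighted `ℓ¹` sequence is in `ℓ^σ` if the weight grows fast enough. -/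
theorem summable_rpow_of_weighted {R : ι → ℝ} (hR : ∀ j, 1 < R j) {σ : ℝ} (hσ0 : 0 < σ)
    (hσ1 : σ < 1) (hRs : Summable fun j => R j ^ (-(σ / (1 - σ)))) {c : (ι →₀ ℕ) → ℝ}
    (hc : Summable fun ν => |c ν| * mono R ν) : Summable fun ν => |c ν| ^ σ := by
  have hσ : 0 < 1 - σ := sub_pos.2 hσ1
  have hR0 : ∀ j, 0 < R j := fun j => zero_lt_one.trans (hR j)
  have hm := summable_mono (fun j => (Real.rpow_pos_of_pos (hR0 j) _).le)
    (fun j => Real.rpow_lt_one_of_one_lt_of_neg (hR j) (neg_lt_zero.2 (div_pos hσ0 hσ))) hRs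
  refine Summable.of_nonneg_of_le (fun ν => Real.rpow_nonneg (abs_nonneg _) _) (fun ν => ?_)
    ((hc.mul_left σ).add (hm.mul_left (1 - σ)))
  have hp := mono_pos hR0 ν
  -- Young's inequality with weights `σ` and `1 - σ` for `|c_ν| R^ν` and `R^(-νσ/(1-σ))`; the powers
  -- of `R` cancel in the geometric mean.
  have hy := Real.geom_mean_le_arith_mean2_weighted hσ0.le hσ.le
    (mul_nonneg (abs_nonneg (c ν)) hp.le) (Real.rpow_pos_of_pos hp (-(σ / (1 - σ)))).le
    (add_sub_cancel _ _)
  rw [mono_rpow fun j => (hR0 j).le]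
  refine le_trans (le_of_eq ?_) hy
  rw [Real.mul_rpow (abs_nonneg _) hp.le, ← Real.rpow_mul hp.le, mul_assoc, ← Real.rpow_add hp]
  have : σ + -(σ / (1 - σ)) * (1 - σ) = 0 := by field_simp; ring
  rw [this, Real.rpow_zero, mul_one]

/-- The weights will be negative powers, so vanishing `b_j` must be made positive without spending
the gap `1 - ∑ b_j`. -/
theorem exists_pos_perturbation [Countable ι] {b : ι → ℝ} (hb : ∀ j, 0 ≤ b j) (hbs : Summable b)
    (hb1 : ∑' j, b j < 1) {σ : ℝ} (hσ0 : 0 < σ) (hσ1 : σ < 1)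
    (hbσ : Summable fun j => b j ^ σ) :
    ∃ α : ι → ℝ, (∀ j, 0 < α j) ∧ (∀ j, b j ≤ α j) ∧ Summable α ∧ ∑' j, α j < 1 ∧
      Summable fun j => α j ^ σ := by
  set γ : NNReal := (1 - ∑' j, b j).toNNReal with hγ
  have hγ0 : γ ≠ 0 := (Real.toNNReal_pos.2 (sub_pos.2 hb1)).ne'
  obtain ⟨δ, hδ0, s, hδs, hsγ⟩ := NNReal.exists_pos_sum_of_countable hγ0 ι
  have hδs' : HasSum (fun j => (δ j : ℝ)) s := NNReal.hasSum_coe.2 hδs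
  have hsγ' : (s : ℝ) < 1 - ∑' j, b j := by
    have : (s : ℝ) < γ := hsγ
    rwa [hγ, Real.coe_toNNReal _ (sub_pos.2 hb1).le] at this
  have hδ1 : ∀ j, (δ j : ℝ) ≤ 1 := fun j => by
    have h1 := le_hasSum hδs' j fun i _ => (δ i).2
    have h2 : 0 ≤ ∑' j, b j := tsum_nonneg hb
    linarith
  have hδpos : ∀ j, (0 : ℝ) < δ j := hδ0
  have hle : ∀ j, (δ j : ℝ) ^ σ⁻¹ ≤ δ j := fun j => by
    simpa using Real.rpow_le_rpow_of_exponent_ge (hδpos j) (hδ1 j) ((one_le_inv₀ hσ0).2 hσ1.le)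
  have hε : Summable fun j => (δ j : ℝ) ^ σ⁻¹ :=
    Summable.of_nonneg_of_le (fun j => (Real.rpow_pos_of_pos (hδpos j) _).le) hle hδs'.summable
  -- The increment `δ_j^(1/σ)` is at most `δ_j`, which keeps the sum below `1`; its `σ`-th power is
  -- `δ_j`, and `t ↦ t^σ` is subadditive.
  refine ⟨fun j => b j + (δ j : ℝ) ^ σ⁻¹,
    fun j => add_pos_of_nonneg_of_pos (hb j) (Real.rpow_pos_of_pos (hδpos j) _),
    fun j => le_add_of_nonneg_right (Real.rpow_pos_of_pos (hδpos j) _).le, hbs.add hε, ?_, ?_⟩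
  · rw [hbs.tsum_add hε]
    have := hε.tsum_le_tsum hle hδs'.summable
    rw [hδs'.tsum_eq] at this
    linarith
  · refine Summable.of_nonneg_of_le (fun j => Real.rpow_nonneg
      (add_nonneg (hb j) (Real.rpow_pos_of_pos (hδpos j) _).le) _) (fun j => ?_)
      (hbσ.add hδs'.summable)
    refine (Real.rpow_add_le_add_rpow (hb j) (Real.rpow_pos_of_pos (hδpos j) _).le
      hσ0.le hσ1.le).trans (le_of_eq ?_)
    rw [Real.rpow_inv_rpow (hδpos j).le hσ0.ne']

/-- The choice `R_j = α_j^(σ-1)` makes both `R_j α_j` and `R_j^(-σ/(1-σ))` equal to `α_j^σ`. It is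
affordable only in the tail, where `∑ α_j^σ < γ/2`; on the finite set `A` the factor `1 + γ/2` is
used. The total is below `(1 + γ/2) s + γ/2 < 1`, since `s = 1 - γ < 1`. -/
theorem exists_weights [Countable ι] {b : ι → ℝ} (hb : ∀ j, 0 ≤ b j) (hbs : Summable b)
    (hb1 : ∑' j, b j < 1) {σ : ℝ} (hσ0 : 0 < σ) (hσ1 : σ < 1)
    (hbσ : Summable fun j => b j ^ σ) :
    ∃ R : ι → ℝ, (∀ j, 1 < R j) ∧ Summable (fun j => R j * b j) ∧ ∑' j, R j * b j < 1 ∧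
      Summable fun j => R j ^ (-(σ / (1 - σ))) := by
  classical
  obtain ⟨α, hα0, hbα, hαs, hα1, hασ⟩ := exists_pos_perturbation hb hbs hb1 hσ0 hσ1 hbσ
  have hσ : 0 < 1 - σ := sub_pos.2 hσ1
  set s := ∑' j, α j with hs
  have hs0 : 0 ≤ s := tsum_nonneg fun j => (hα0 j).le
  have hαlt : ∀ j, α j < 1 := fun j => (hαs.le_tsum j fun i _ => (hα0 i).le).trans_lt hα1
  have hασ0 : ∀ j, 0 < α j ^ σ := fun j => Real.rpow_pos_of_pos (hα0 j) _
  set γ := 1 - s with hγ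
  have hγ0 : 0 < γ := sub_pos.2 hα1
  obtain ⟨A, hA⟩ := ((tendsto_order.1 (tendsto_tsum_compl_atTop_zero fun j => α j ^ σ)).2 (γ / 2)
    (half_pos hγ0)).exists
  set R : ι → ℝ := fun j => if j ∈ A then 1 + γ / 2 else α j ^ (σ - 1) with hRdef
  have hR : ∀ j, 1 < R j := fun j => by
    by_cases hj : j ∈ A
    · simp [hRdef, hj, hγ0]
    · simpa [hRdef, hj] using
        Real.one_lt_rpow_of_pos_of_lt_one_of_neg (hα0 j) (hαlt j) (by linarith)
  set T : ι → ℝ := Set.indicator {j | j ∉ A} (fun j => α j ^ σ) with hT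
  have hTs : Summable T := hασ.indicator _
  have hTt : ∑' j, T j < γ / 2 := by
    rw [hT, ← tsum_subtype]
    exact hA
  have hle : ∀ j, R j * b j ≤ (1 + γ / 2) * α j + T j := fun j => by
    refine (mul_le_mul_of_nonneg_left (hbα j) (zero_le_one.trans (hR j).le)).trans ?_
    by_cases hj : j ∈ A
    · simp [hRdef, hT, hj]
    · have h1 : α j ^ (σ - 1) * α j = α j ^ σ := by
        rw [Real.rpow_sub_one (hα0 j).ne', div_mul_cancel₀ _ (hα0 j).ne']
      have h2 : 0 ≤ (1 + γ / 2) * α j := mul_nonneg (by linarith) (hα0 j).le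
      simpa [hRdef, hT, hj, h1] using h2
  have hsum := (hαs.mul_left (1 + γ / 2)).add hTs
  have hRb : Summable fun j => R j * b j := Summable.of_nonneg_of_le
    (fun j => mul_nonneg (zero_le_one.trans (hR j).le) (hb j)) hle hsum
  refine ⟨R, hR, hRb, ?_, ?_⟩
  · have h := hRb.tsum_le_tsum hle hsum
    rw [(hαs.mul_left (1 + γ / 2)).tsum_add hTs, tsum_mul_left, ← hs] at h
    nlinarith
  · refine hασ.congr_cofinite ?_
    filter_upwards [A.finite_toSet.compl_mem_cofinite] with j hj
    have hj' : j ∉ A := hj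
    simp only [hRdef, hj', if_false]
    rw [← Real.rpow_mul (hα0 j).le]
    congr 1
    field_simp
    ring

end Summability

end EllipticInverse

noncomputable section

namespace EllipticInverse

/-! ### The Poincaré inequality -/

section Poincare

variable {d : ℕ} {D : Set (EuclideanSpace ℝ (Fin d))}

theorem neg_two_mul_le (a : ℝ) {b l r g : ℝ} (hl : |l| ≤ r) (hb : |b| ≤ g) :
    -(2 * a * b * l) ≤ 1 / 2 * a ^ 2 + 2 * r ^ 2 * g ^ 2 := by
  have h3 : |b * l| ≤ g * r := by
    rw [abs_mul]
    exact mul_le_mul hb hl (abs_nonneg _) ((abs_nonneg _).trans hb)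
  have h4 : (b * l) ^ 2 ≤ (g * r) ^ 2 := sq_le_sq' (abs_le.1 h3).1 (abs_le.1 h3).2
  nlinarith [sq_nonneg (a + 2 * (b * l))]

theorem integrable_mul_of_hasCompactSupport {f g : EuclideanSpace ℝ (Fin d) → ℝ}
    (hf : Continuous f) (hfc : HasCompactSupport f) (hg : Continuous g) :
    Integrable (fun x => f x * g x) :=
  (hf.mul hg).integrable_of_hasCompactSupport (HasCompactSupport.mul_right hfc)

/-- Integrate by parts against the coordinate `x_i`, whose derivative is `1`: `∫ φ² = -∫ 2 φ ∂_iφ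
x_i`. As `|x_i| ≤ r` where `φ ≠ 0`, Young's inequality leaves `½ ∫ φ²` to absorb, whence the
constant `4 r²`. -/
theorem integral_sq_le_integral_gradient_sq (i : Fin d) {φ : EuclideanSpace ℝ (Fin d) → ℝ}
    (hφ : ContDiff ℝ ∞ φ) (hφc : HasCompactSupport φ) {r : ℝ}
    (hr : ∀ x, φ x ≠ 0 → ‖x‖ ≤ r) :
    ∫ x, φ x ^ 2 ≤ 4 * r ^ 2 * ∫ x, ‖gradient φ x‖ ^ 2 := by
  have hd : Differentiable ℝ φ := hφ.differentiable (by simp)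
  have hfc : Continuous (fderiv ℝ φ) := hφ.continuous_fderiv (by simp)
  have hgrad : ∀ x, ‖gradient φ x‖ = ‖fderiv ℝ φ x‖ := fun x => by
    rw [← toDual_gradient, LinearIsometryEquiv.norm_map]
  simp only [hgrad]
  obtain ⟨v, L, hv1, hLv, hLle⟩ : ∃ (v : EuclideanSpace ℝ (Fin d))
      (L : EuclideanSpace ℝ (Fin d) →L[ℝ] ℝ), ‖v‖ = 1 ∧ L v = 1 ∧ ∀ x, |L x| ≤ ‖x‖ :=
    ⟨EuclideanSpace.single i 1, EuclideanSpace.proj i, by simp, by simp,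
      fun x => PiLp.norm_apply_le x i⟩
  have hφ0 : Continuous φ := hφ.continuous
  have hvc : Continuous fun x => fderiv ℝ φ x v := hfc.clm_apply continuous_const
  have hsq : Integrable (fun x => φ x ^ 2) :=
    (integrable_mul_of_hasCompactSupport hφ0 hφc hφ0).congr (.of_forall fun x => (sq _).symm)
  have hgsq : Integrable (fun x => ‖fderiv ℝ φ x‖ ^ 2) := by
    refine (integrable_mul_of_hasCompactSupport hfc.norm (hφc.fderiv ℝ).norm hfc.norm).congr
      (.of_forall fun x => (sq _).symm)
  have hder : ∀ x, fderiv ℝ (fun x => φ x ^ 2) x v = 2 * φ x * fderiv ℝ φ x v := fun x => by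
    rw [((hd x).hasFDerivAt.pow 2).fderiv]
    simp
  have hmix : Integrable (fun x => 2 * φ x * fderiv ℝ φ x v * L x) :=
    (integrable_mul_of_hasCompactSupport hφ0 hφc
      ((continuous_const (y := (2 : ℝ))).mul (hvc.mul L.continuous))).congr
      (.of_forall fun x => by simp only [Pi.mul_apply]; ring)
  have hsqL : Integrable (fun x => φ x ^ 2 * L x) :=
    (integrable_mul_of_hasCompactSupport hφ0 hφc (hφ0.mul L.continuous)).congr
      (.of_forall fun x => by simp only [Pi.mul_apply]; ring)
  have hparts := integral_mul_fderiv_eq_neg_fderiv_mul_of_integrable (μ := volume)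
    (f := fun x => φ x ^ 2) (g := L) (v := v) (by simpa only [hder] using hmix)
    (by simpa only [ContinuousLinearMap.fderiv, hLv, mul_one] using hsq) hsqL
    (fun x _ => (hd x).pow 2) (fun x _ => L.differentiableAt)
  simp only [ContinuousLinearMap.fderiv, hLv, mul_one, hder] at hparts
  have hpt : ∀ x, -(2 * φ x * fderiv ℝ φ x v * L x)
      ≤ 1 / 2 * φ x ^ 2 + 2 * r ^ 2 * ‖fderiv ℝ φ x‖ ^ 2 := fun x => by
    by_cases hx : φ x = 0
    · rw [hx]
      have : 0 ≤ 2 * r ^ 2 * ‖fderiv ℝ φ x‖ ^ 2 := by positivity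
      simpa using this
    · have h1 : |L x| ≤ r := (hLle x).trans (hr x hx)
      have h2 : |fderiv ℝ φ x v| ≤ ‖fderiv ℝ φ x‖ := by
        simpa [hv1] using (fderiv ℝ φ x).le_opNorm v
      exact neg_two_mul_le (φ x) h1 h2
  have hint : ∫ x, φ x ^ 2 ≤ 1 / 2 * (∫ x, φ x ^ 2) + 2 * r ^ 2 * ∫ x, ‖fderiv ℝ φ x‖ ^ 2 := by
    calc ∫ x, φ x ^ 2 = ∫ x, -(2 * φ x * fderiv ℝ φ x v * L x) := by
          rw [hparts, integral_neg]
      _ ≤ ∫ x, (1 / 2 * φ x ^ 2 + 2 * r ^ 2 * ‖fderiv ℝ φ x‖ ^ 2) :=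
          integral_mono hmix.neg ((hsq.const_mul _).add (hgsq.const_mul _)) hpt
      _ = _ := by
          rw [integral_add (hsq.const_mul _) (hgsq.const_mul _), integral_const_mul,
            integral_const_mul]
  linarith

theorem norm_sq_Lp_eq_integral {E : Type*} [NormedAddCommGroup E] [InnerProductSpace ℝ E]
    {α : Type*} [MeasurableSpace α] {μ : Measure α} (g : Lp E 2 μ) :
    ‖g‖ ^ 2 = ∫ x, ‖g x‖ ^ 2 ∂μ := by
  rw [← real_inner_self_eq_norm_sq, L2.inner_def]
  simp only [real_inner_self_eq_norm_sq]

/-- The **Poincaré inequality** on `H¹₀(D)` for a bounded set `D`. -/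
theorem norm_fst_le_norm_grad (hd : 1 ≤ d) {r : ℝ} (hr0 : 0 ≤ r) (hr : ∀ x ∈ D, ‖x‖ ≤ r)
    (p : H10 D) : ‖(p : L2Pair D).fst‖ ≤ 2 * r * ‖grad p‖ := by
  have hclosed : IsClosed {w : L2Pair D | ‖w.fst‖ ≤ 2 * r * ‖w.snd‖} :=
    isClosed_le (WithLp.fstL 2 ℝ _ _).continuous.norm
      ((WithLp.sndL 2 ℝ _ _).continuous.norm.const_mul _)
  -- The inequality is a closed condition, so test functions suffice; extended by zero, they turn
  -- integrals over `D` into integrals over the whole space.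
  refine closure_minimal ?_ hclosed p.2
  rintro w ⟨φ, hφ, hφc, hφD, h1, h2⟩
  have hzero : ∀ x ∉ D, φ x = 0 := fun x hx => image_eq_zero_of_notMem_tsupport fun h => hx (hφD h)
  have hzero' : ∀ x ∉ D, gradient φ x = 0 := fun x hx => by
    have : fderiv ℝ φ x = 0 := image_eq_zero_of_notMem_tsupport
      fun h => hx (hφD (tsupport_fderiv_subset ℝ h))
    simp [gradient, this]
  have key := integral_sq_le_integral_gradient_sq ⟨0, hd⟩ hφ hφc (r := r)
    fun x hx => hr x (by_contra fun h => hx (hzero x h))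
  have e1 : ‖w.fst‖ ^ 2 = ∫ x, φ x ^ 2 := by
    rw [norm_sq_Lp_eq_integral, ← setIntegral_eq_integral_of_forall_compl_eq_zero (s := D)
      (f := fun x => φ x ^ 2) (fun x hx => by simp [hzero x hx])]
    refine integral_congr_ae ?_
    filter_upwards [h1] with x hx
    simp [hx]
  have e2 : ‖w.snd‖ ^ 2 = ∫ x, ‖gradient φ x‖ ^ 2 := by
    rw [norm_sq_Lp_eq_integral, ← setIntegral_eq_integral_of_forall_compl_eq_zero (s := D)
      (f := fun x => ‖gradient φ x‖ ^ 2) (fun x hx => by simp [hzero' x hx])]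
    refine integral_congr_ae ?_
    filter_upwards [h2] with x hx
    rw [hx]
  refine (sq_le_sq₀ (norm_nonneg _) (by positivity)).1 ?_
  rw [mul_pow, mul_pow, e1, e2]
  linarith

end Poincare

/-! ### Coercive operators on a Hilbert space -/

section Coercive

variable {H : Type*} [NormedAddCommGroup H] [InnerProductSpace ℝ H]

/-- Lax–Milgram for the form `⟪A g, w⟫`: the isomorphism it provides is `A` itself. -/
theorem isUnit_of_coercive [CompleteSpace H] {A : H →L[ℝ] H} {c : ℝ} (hc : 0 < c)
    (h : ∀ g, c * ‖g‖ ^ 2 ≤ ⟪A g, g⟫_ℝ) : IsUnit A := by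
  have hB : IsCoercive ((innerSL ℝ).comp A) := ⟨c, hc, fun g => by
    simpa [pow_two, mul_assoc] using h g⟩
  refine ⟨ContinuousLinearEquiv.toUnit hB.continuousLinearEquivOfBilin, ?_⟩
  ext g
  refine ext_inner_right ℝ fun w => ?_
  exact hB.continuousLinearEquivOfBilin_apply g w

theorem mul_norm_le_of_coercive {A : H →L[ℝ] H} {c : ℝ}
    (h : ∀ g, c * ‖g‖ ^ 2 ≤ ⟪A g, g⟫_ℝ) (g : H) : c * ‖g‖ ≤ ‖A g‖ := by
  rcases (norm_nonneg g).eq_or_lt with h0 | h0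
  · simp [← h0]
  · refine le_of_mul_le_mul_right ?_ h0
    calc c * ‖g‖ * ‖g‖ = c * ‖g‖ ^ 2 := by ring
      _ ≤ ⟪A g, g⟫_ℝ := h g
      _ ≤ ‖A g‖ * ‖g‖ := real_inner_le_norm _ _

theorem mul_inverse_apply {A : H →L[ℝ] H} (hA : IsUnit A) (g : H) : A (Ring.inverse A g) = g := by
  rw [← mul_apply_eq_comp, Ring.mul_inverse_cancel A hA, one_apply_eq_self]

theorem inverse_mul_apply {A : H →L[ℝ] H} (hA : IsUnit A) (g : H) : Ring.inverse A (A g) = g := by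
  rw [← mul_apply_eq_comp, Ring.inverse_mul_cancel A hA, one_apply_eq_self]

theorem norm_inverse_le_of_coercive [CompleteSpace H] {A : H →L[ℝ] H} {c : ℝ} (hc : 0 < c)
    (h : ∀ g, c * ‖g‖ ^ 2 ≤ ⟪A g, g⟫_ℝ) : ‖Ring.inverse A‖ ≤ c⁻¹ := by
  refine ContinuousLinearMap.opNorm_le_bound _ (inv_nonneg.2 hc.le) fun g => ?_
  have := mul_norm_le_of_coercive h (Ring.inverse A g)
  rw [mul_inverse_apply (isUnit_of_coercive hc h)] at this
  rwa [← div_eq_inv_mul, le_div_iff₀' hc]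

end Coercive

/-! ### The energy space -/

section Energy

variable {d : ℕ} {D : Set (EuclideanSpace ℝ (Fin d))}

instance : CompleteSpace (H10 D) :=
  (testPairs D).isClosed_topologicalClosure.completeSpace_coe

/-- The gradient as a continuous linear map. -/
def gradL (D : Set (EuclideanSpace ℝ (Fin d))) :
    H10 D →L[ℝ] Lp (EuclideanSpace ℝ (Fin d)) 2 (dom D) :=
  (WithLp.sndL 2 ℝ _ _).comp (H10 D).subtypeL

/-- By Poincaré, `‖∇p‖` controls the full norm; hence `∇` is injective with closed range. -/
theorem antilipschitzWith_gradL (hd : 1 ≤ d) (hD : Bornology.IsBounded D) :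
    ∃ K, AntilipschitzWith K (gradL D) := by
  obtain ⟨r, hr0, hr⟩ := hD.exists_pos_norm_le
  refine ⟨⟨2 * r + 1, by positivity⟩, (gradL D).antilipschitz_of_bound fun p => ?_⟩
  have h1 := norm_fst_le_norm_grad hd hr0.le hr p
  have h2 := WithLp.prod_norm_sq_eq_of_L2 (p : L2Pair D)
  have h3 : ‖(p : L2Pair D)‖ ≤ ‖(p : L2Pair D).fst‖ + ‖(p : L2Pair D).snd‖ := by
    refine (sq_le_sq₀ (norm_nonneg _) (by positivity)).1 ?_
    have := mul_nonneg (norm_nonneg (p : L2Pair D).fst) (norm_nonneg (p : L2Pair D).snd)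
    nlinarith
  change ‖(p : L2Pair D)‖ ≤ (2 * r + 1) * ‖grad p‖
  change ‖(p : L2Pair D)‖ ≤ _ + ‖grad p‖ at h3
  linarith

/-- The multiplication operator on `L²(D; ℝ^d)` with a coefficient in `L^∞(D)`. -/
def mulL (D : Set (EuclideanSpace ℝ (Fin d))) :
    Linfty D →L[ℝ] Lp (EuclideanSpace ℝ (Fin d)) 2 (dom D) →L[ℝ]
      Lp (EuclideanSpace ℝ (Fin d)) 2 (dom D) :=
  (ContinuousLinearMap.lsmul ℝ ℝ).holderL (dom D) ∞ 2 2

theorem inner_mulL (u : Linfty D) (g h : Lp (EuclideanSpace ℝ (Fin d)) 2 (dom D)) :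
    ⟪mulL D u g, h⟫_ℝ = ∫ x in D, u x * ⟪g x, h x⟫_ℝ := by
  rw [L2.inner_def]
  refine integral_congr_ae ?_
  filter_upwards [(ContinuousLinearMap.lsmul ℝ ℝ).coeFn_holder (r := 2) u g] with x hx
  rw [← real_inner_smul_left]
  congr 1

theorem norm_mulL_le (u : Linfty D) : ‖mulL D u‖ ≤ ‖u‖ := by
  refine ((mulL D).le_opNorm u).trans (mul_le_of_le_one_left (norm_nonneg _) ?_)
  exact (ContinuousLinearMap.norm_holderL_le _).trans ContinuousLinearMap.opNorm_lsmul_le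

theorem le_inner_mulL {u : Linfty D} {c : ℝ} (hu : ∀ᵐ x ∂(dom D), c ≤ u x)
    (g : Lp (EuclideanSpace ℝ (Fin d)) 2 (dom D)) : c * ‖g‖ ^ 2 ≤ ⟪mulL D u g, g⟫_ℝ := by
  have hg : Integrable (fun x => ⟪g x, g x⟫_ℝ) (dom D) := L2.integrable_inner g g
  have hug : Integrable (fun x => u x * ⟪g x, g x⟫_ℝ) (dom D) := by
    refine (L2.integrable_inner (𝕜 := ℝ) (mulL D u g) g).congr ?_
    filter_upwards [(ContinuousLinearMap.lsmul ℝ ℝ).coeFn_holder (r := 2) u g] with x hx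
    rw [← real_inner_smul_left]
    congr 1
  rw [inner_mulL, norm_sq_Lp_eq_integral, ← integral_const_mul]
  refine integral_mono_ae (by simpa only [real_inner_self_eq_norm_sq] using hg.const_mul c) hug ?_
  filter_upwards [hu] with x hx
  rw [real_inner_self_eq_norm_sq]
  exact mul_le_mul_of_nonneg_right hx (sq_nonneg _)

/-- Up to an isomorphism `H¹₀(D)` is a Hilbert space with the energy norm `‖∇p‖`, on which the
elliptic operators act boundedly and coercively. -/
theorem exists_energySpace (hd : 1 ≤ d) (hD : Bornology.IsBounded D) :
    ∃ (S : Submodule ℝ (Lp (EuclideanSpace ℝ (Fin d)) 2 (dom D))) (_ : CompleteSpace S)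
      (e : H10 D ≃L[ℝ] S) (T : Linfty D →L[ℝ] S →L[ℝ] S),
      (∀ u p q, ⟪T u (e p), e q⟫_ℝ = ∫ x in D, u x * ⟪grad p x, grad q x⟫_ℝ) ∧
      (∀ u, ‖T u‖ ≤ ‖u‖) ∧
      ∀ (u : Linfty D) (c : ℝ), (∀ᵐ x ∂(dom D), c ≤ u x) →
        ∀ g, c * ‖g‖ ^ 2 ≤ ⟪T u g, g⟫_ℝ := by
  obtain ⟨K, hK⟩ := antilipschitzWith_gradL hd hD
  have hcl : IsClosed (Set.range (gradL D)) := hK.isClosed_range (gradL D).uniformContinuous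
  have hinj : Function.Injective (gradL D) := hK.injective
  have hS : CompleteSpace (gradL D).range := completeSpace_coe_iff_isComplete.2 hcl.isComplete
  set S := (gradL D).range
  have he : ∀ p, ((ContinuousLinearMap.equivRange hinj hcl p : S) :
      Lp (EuclideanSpace ℝ (Fin d)) 2 (dom D)) = grad p := fun p => by
    rw [ContinuousLinearMap.coe_equivRange]
    rfl
  -- The projection disappears in inner products with elements of `S`. Using the `L²` norm of
  -- gradients keeps the constants exact, so no Poincaré constant enters the ratio `‖ψ_j‖ / c`.
  let T : Linfty D →L[ℝ] S →L[ℝ] S :=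
    (S.orthogonalProjectionOnto.postcomp S).comp ((S.subtypeL.precomp _).comp (mulL D))
  have hT : ∀ u g, T u g = S.orthogonalProjectionOnto (mulL D u g) := fun u g => rfl
  have hTi : ∀ u (g h : S), ⟪T u g, h⟫_ℝ =
      ⟪mulL D u g, (h : Lp (EuclideanSpace ℝ (Fin d)) 2 (dom D))⟫_ℝ := fun u g h => by
    rw [hT, Submodule.inner_orthogonalProjectionOnto_eq_of_mem_right]
  refine ⟨S, hS, ContinuousLinearMap.equivRange hinj hcl, T, fun u p q => ?_, fun u => ?_,
    fun u c hu g => ?_⟩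
  · rw [hTi, he, he, inner_mulL]
  · refine ContinuousLinearMap.opNorm_le_bound _ (norm_nonneg _) fun g => ?_
    rw [hT]
    calc _ ≤ ‖S.orthogonalProjectionOnto‖ * ‖mulL D u g‖ := ContinuousLinearMap.le_opNorm _ _
      _ ≤ 1 * (‖mulL D u‖ * ‖(g : Lp (EuclideanSpace ℝ (Fin d)) 2 (dom D))‖) :=
          mul_le_mul (S.orthogonalProjectionOnto_norm_le) ((mulL D u).le_opNorm _)
            (norm_nonneg _) zero_le_one
      _ ≤ _ := by
          rw [one_mul]
          exact mul_le_mul_of_nonneg_right (norm_mulL_le u) (norm_nonneg _)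
  · rw [hTi]
    exact le_inner_mulL hu g

end Energy

end EllipticInverse

end

noncomputable section

namespace EllipticInverse

/-! ### The forward map and the posterior density -/

section Posterior

variable {ι : Type*} {d : ℕ} {D : Set (EuclideanSpace ℝ (Fin d))}
  {H : Type*} [NormedAddCommGroup H] [InnerProductSpace ℝ H]

theorem isWeakSolution_iff {e : H10 D ≃L[ℝ] H} {T : Linfty D →L[ℝ] H →L[ℝ] H}
    (hT : ∀ u p q, ⟪T u (e p), e q⟫_ℝ = ∫ x in D, u x * ⟪grad p x, grad q x⟫_ℝ)
    {f : H10 D →L[ℝ] ℝ} {F : H} (hF : ∀ q, ⟪F, e q⟫_ℝ = f q) {u : Linfty D} {p : H10 D} :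
    IsWeakSolution f u p ↔ T u (e p) = F := by
  constructor
  · intro h
    refine ext_inner_right ℝ fun w => ?_
    obtain ⟨q, rfl⟩ := e.surjective w
    rw [hT, hF, h q]
  · intro h q
    rw [← hT, h, hF]

theorem isWeakSolution_iff_eq {e : H10 D ≃L[ℝ] H} {T : Linfty D →L[ℝ] H →L[ℝ] H}
    (hT : ∀ u p q, ⟪T u (e p), e q⟫_ℝ = ∫ x in D, u x * ⟪grad p x, grad q x⟫_ℝ)
    {f : H10 D →L[ℝ] ℝ} {F : H} (hF : ∀ q, ⟪F, e q⟫_ℝ = f q) {u : Linfty D}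
    (hu : IsUnit (T u)) {p : H10 D} :
    IsWeakSolution f u p ↔ p = e.symm (Ring.inverse (T u) F) := by
  rw [isWeakSolution_iff hT hF]
  constructor
  · intro h
    rw [← h, inverse_mul_apply hu, e.symm_apply_apply]
  · intro h
    rw [h, e.apply_symm_apply, mul_inverse_apply hu]

theorem forwardMap_eq {e : H10 D ≃L[ℝ] H} {T : Linfty D →L[ℝ] H →L[ℝ] H}
    (hT : ∀ u p q, ⟪T u (e p), e q⟫_ℝ = ∫ x in D, u x * ⟪grad p x, grad q x⟫_ℝ)
    {f : H10 D →L[ℝ] ℝ} {F : H} (hF : ∀ q, ⟪F, e q⟫_ℝ = f q) {u : Linfty D}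
    (hu : IsUnit (T u)) : forwardMap f u = e.symm (Ring.inverse (T u) F) := by
  have h : ∃ p, IsWeakSolution f u p := ⟨_, (isWeakSolution_iff_eq hT hF hu).2 rfl⟩
  rw [forwardMap, dif_pos h]
  exact (isWeakSolution_iff_eq hT hF hu).1 h.choose_spec

theorem summable_smul_of_mem_paramDomain {X : Type*} [NormedAddCommGroup X] [NormedSpace ℝ X]
    [CompleteSpace X] {ψ : ι → X} (hψ : Summable fun j => ‖ψ j‖) {y : ι → ℝ}
    (hy : y ∈ paramDomain ι) : Summable fun j => y j • ψ j := by
  refine Summable.of_norm_bounded hψ fun j => ?_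
  rw [norm_smul]
  exact mul_le_of_le_one_left (norm_nonneg _) (abs_le.2 (hy j))

/-- The solution operator along `a + ∑ y_j ψ_j` as a Neumann series around `a`. -/
theorem inverse_coeff_eq_tsum [CompleteSpace H] {T : Linfty D →L[ℝ] H →L[ℝ] H} {a : Linfty D}
    (ha : IsUnit (T a)) {ψ : ι → Linfty D} (hψ : Summable fun j => ‖ψ j‖)
    {y : ι → ℝ} (hy : y ∈ paramDomain ι) (hu : IsUnit (T (coeff a ψ y)))
    (hC : Summable fun j => ‖Ring.inverse (T a) * T (ψ j)‖)
    (hC1 : ∑' j, ‖Ring.inverse (T a) * T (ψ j)‖ < 1) (F : H) :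
    Ring.inverse (T (coeff a ψ y)) F =
      ∑' n : ℕ, ((-∑' j, y j • (Ring.inverse (T a) * T (ψ j))) ^ n) (Ring.inverse (T a) F) := by
  have hyψ := summable_smul_of_mem_paramDomain hψ hy
  have hyC := summable_smul_of_mem_paramDomain hC hy
  set K : H →L[ℝ] H := -∑' j, y j • (Ring.inverse (T a) * T (ψ j)) with hK
  have hK1 : ‖K‖ < 1 := by
    rw [hK, norm_neg]
    refine (tsum_of_norm_bounded hC.hasSum fun j => ?_).trans_lt hC1
    rw [norm_smul]
    exact mul_le_of_le_one_left (norm_nonneg _) (abs_le.2 (hy j))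
  -- Factoring out the mean field reduces inversion to the geometric series of `K`.
  have hTy : T (coeff a ψ y) = T a * (1 - K) := by
    have h1 : HasSum (fun j => y j • T (ψ j)) (T (∑' j, y j • ψ j)) := by
      simpa using hyψ.hasSum.mapL T
    have h2 : HasSum (fun j => y j • T (ψ j)) (T a * -K) := by
      rw [hK, neg_neg]
      refine (hyC.hasSum.mul_left (T a)).congr_fun fun j => ?_
      rw [mul_smul_comm, ← mul_assoc, Ring.mul_inverse_cancel _ ha, one_mul]
    rw [coeff, map_add, h1.unique h2, sub_eq_add_neg, mul_add, mul_one]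
  have hsum := summable_geometric_of_norm_lt_one hK1
  have happ : ∑' n : ℕ, (K ^ n) (Ring.inverse (T a) F)
      = (∑' n : ℕ, K ^ n) (Ring.inverse (T a) F) :=
    (hsum.hasSum.mapL (ContinuousLinearMap.apply ℝ H (Ring.inverse (T a) F))).tsum_eq
  have hFeq : T (coeff a ψ y) (∑' n : ℕ, (K ^ n) (Ring.inverse (T a) F)) = F := by
    rw [happ, hTy, mul_apply_eq_comp, ← mul_apply_eq_comp (1 - K),
      mul_neg_geom_series K hK1, one_apply_eq_self, mul_inverse_apply ha]
  rw [← inverse_mul_apply hu (∑' n : ℕ, (K ^ n) (Ring.inverse (T a) F)), hFeq]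

theorem potential_eq_sum {K : ℕ} (f : H10 D →L[ℝ] ℝ) (o : Fin K → (H10 D →L[ℝ] ℝ))
    (Γ : Matrix (Fin K) (Fin K) ℝ) (δ : Fin K → ℝ) (u : Linfty D) :
    potential f o Γ δ u = 1 / 2 * ∑ k, (δ k - o k (forwardMap f u)) *
      ∑ l, Γ⁻¹ k l * (δ l - o l (forwardMap f u)) := rfl

theorem HasMonomialExpansion.posteriorDensity {R : ι → ℝ} (hR : ∀ j, 1 ≤ R j) {K : ℕ} {N : ℝ}
    {f : H10 D →L[ℝ] ℝ} {a : Linfty D} {ψ : ι → Linfty D}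
    (h : HasMonomialExpansion R N fun y => forwardMap f (coeff a ψ y))
    (o : Fin K → (H10 D →L[ℝ] ℝ)) (Γ : Matrix (Fin K) (Fin K) ℝ) (δ : Fin K → ℝ) :
    ∃ M, HasMonomialExpansion R M (posteriorDensity f o Γ δ a ψ) := by
  have he : ∀ k, HasMonomialExpansion R _ fun y => δ k + (-1 : ℝ) • o k (forwardMap f (coeff a ψ y)) :=
    fun k => (HasMonomialExpansion.const R (δ k)).add hR ((h.clm_apply hR (o k)).const_smul hR (-1))
  have hs := (HasMonomialExpansion.sum hR Finset.univ fun k => (he k).mul hR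
    (HasMonomialExpansion.sum hR Finset.univ fun l => (he l).const_smul hR (Γ⁻¹ k l))).const_smul
      hR (-(1 / 2))
  obtain ⟨M, hM⟩ := hs.exp hR
  refine ⟨M, hM.congr fun y _ => ?_⟩
  rw [EllipticInverse.posteriorDensity, potential_eq_sum]
  congr 1
  simp only [smul_eq_mul, neg_mul, one_mul, ← sub_eq_add_neg]

/-- Invertibility is an open condition, so near `u` the default value `0` of `forwardMap` is never
taken and the map is operator inversion between bounded linear maps. -/
theorem contDiffAt_forwardMap [CompleteSpace H] {e : H10 D ≃L[ℝ] H} {T : Linfty D →L[ℝ] H →L[ℝ] H}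
    (hT : ∀ u p q, ⟪T u (e p), e q⟫_ℝ = ∫ x in D, u x * ⟪grad p x, grad q x⟫_ℝ)
    {f : H10 D →L[ℝ] ℝ} {F : H} (hF : ∀ q, ⟪F, e q⟫_ℝ = f q) {u : Linfty D}
    (hu : IsUnit (T u)) : ContDiffAt ℝ ∞ (forwardMap f) u := by
  obtain ⟨A, hA⟩ := hu
  have hev : forwardMap f =ᶠ[nhds u] fun v => e.symm (Ring.inverse (T v) F) := by
    have h1 : ∀ᶠ B in nhds (T u), IsUnit B := hA ▸ Units.nhds A
    filter_upwards [T.continuous.continuousAt.eventually h1] with v hv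
    exact forwardMap_eq hT hF hv
  refine ContDiffAt.congr_of_eventuallyEq ?_ hev
  have hinv : ContDiffAt ℝ ∞ Ring.inverse (T u) := hA ▸ contDiffAt_ringInverse ℝ A
  have h2 : ContDiffAt ℝ ∞ (fun v => Ring.inverse (T v)) u := hinv.comp u T.contDiff.contDiffAt
  exact e.symm.contDiff.contDiffAt.comp u (h2.clm_apply contDiffAt_const)

theorem smoothAtZero_posteriorDensity {K : ℕ} {f : H10 D →L[ℝ] ℝ} {a : Linfty D}
    (h : ContDiffAt ℝ ∞ (forwardMap f) a) (ψ : ι → Linfty D)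
    (o : Fin K → (H10 D →L[ℝ] ℝ)) (Γ : Matrix (Fin K) (Fin K) ℝ) (δ : Fin K → ℝ) :
    SmoothAtZero (posteriorDensity f o Γ δ a ψ) := by
  intro S
  -- With finitely many active variables the series is a finite sum, so the coefficient is affine in
  -- `t`.
  have hc : ∀ t : S → ℝ, coeff a ψ (Function.extend Subtype.val t 0) = a + ∑ s, t s • ψ s := by
    intro t
    have : (fun j => Function.extend Subtype.val t (0 : ι → ℝ) j • ψ j)
        = Function.extend Subtype.val (fun s : S => t s • ψ s) 0 := by
      funext j
      by_cases hj : ∃ s : S, s.1 = j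
      · obtain ⟨s, rfl⟩ := hj
        rw [Subtype.val_injective.extend_apply, Subtype.val_injective.extend_apply]
      · rw [Function.extend_apply' _ _ _ hj, Function.extend_apply' _ _ _ hj]
        simp
    rw [coeff, this, tsum_extend_zero Subtype.val_injective, tsum_fintype]
  have hG : ContDiffAt ℝ ∞ (fun t : S → ℝ =>
      forwardMap f (coeff a ψ (Function.extend Subtype.val t 0))) 0 := by
    simp only [hc]
    refine ContDiffAt.comp (g := forwardMap f) (f := fun t : S → ℝ => a + ∑ s, t s • ψ s) 0 ?_ ?_
    · simpa using h
    · refine contDiffAt_const.add (ContDiffAt.sum fun s _ => ?_)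
      exact (contDiff_apply ℝ ℝ s).contDiffAt.smul contDiffAt_const
  simp only [posteriorDensity, potential_eq_sum]
  have he : ∀ k, ContDiffAt ℝ ∞ (fun t : S → ℝ =>
      δ k - o k (forwardMap f (coeff a ψ (Function.extend Subtype.val t 0)))) 0 := fun k =>
    contDiffAt_const.sub ((o k).contDiff.contDiffAt.comp _ hG)
  exact (contDiffAt_const.mul (ContDiffAt.sum fun k _ => (he k).mul
    (ContDiffAt.sum fun l _ => contDiffAt_const.mul (he l)))).neg.exp

theorem exists_weights_hasMonomialExpansion_forwardMap [Countable ι] [CompleteSpace H]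
    {e : H10 D ≃L[ℝ] H} {T : Linfty D →L[ℝ] H →L[ℝ] H}
    (hT : ∀ u p q, ⟪T u (e p), e q⟫_ℝ = ∫ x in D, u x * ⟪grad p x, grad q x⟫_ℝ)
    (hTn : ∀ u, ‖T u‖ ≤ ‖u‖) {f : H10 D →L[ℝ] ℝ} {F : H} (hF : ∀ q, ⟪F, e q⟫_ℝ = f q)
    {a : Linfty D} {ψ : ι → Linfty D} {c : ℝ} (hc : 0 < c)
    (hTa : ∀ g, c * ‖g‖ ^ 2 ≤ ⟪T a g, g⟫_ℝ)
    (hu : ∀ y ∈ paramDomain ι, IsUnit (T (coeff a ψ y)))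
    (hψ : Summable fun j => ‖ψ j‖) (hψc : ∑' j, ‖ψ j‖ < c)
    {σ : ℝ} (hσ0 : 0 < σ) (hσ1 : σ < 1) (hψσ : Summable fun j => ‖ψ j‖ ^ σ) :
    ∃ (R : ι → ℝ) (N : ℝ), (∀ j, 1 < R j) ∧ Summable (fun j => R j ^ (-(σ / (1 - σ)))) ∧
      HasMonomialExpansion R N fun y => forwardMap f (coeff a ψ y) := by
  have hTu : IsUnit (T a) := isUnit_of_coercive hc hTa
  set b : ι → ℝ := fun j => c⁻¹ * ‖ψ j‖ with hb
  have hb0 : ∀ j, 0 ≤ b j := fun j => by positivity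
  have hbs : Summable b := hψ.mul_left _
  have hb1 : ∑' j, b j < 1 := by
    rw [hb, tsum_mul_left, inv_mul_lt_iff₀ hc, mul_one]
    exact hψc
  have hbσ : Summable fun j => b j ^ σ := by
    refine (hψσ.mul_left (c⁻¹ ^ σ)).congr fun j => ?_
    rw [Real.mul_rpow (by positivity) (norm_nonneg _)]
  have hCb : ∀ j, ‖Ring.inverse (T a) * T (ψ j)‖ ≤ b j := fun j =>
    (norm_mul_le _ _).trans (mul_le_mul (norm_inverse_le_of_coercive hc hTa)
      (hTn _) (norm_nonneg _) (by positivity))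
  obtain ⟨R, hR, hRb, hRb1, hRs⟩ := exists_weights hb0 hbs hb1 hσ0 hσ1 hbσ
  have hR1 : ∀ j, 1 ≤ R j := fun j => (hR j).le
  have hC : Summable fun j => ‖Ring.inverse (T a) * T (ψ j)‖ :=
    Summable.of_nonneg_of_le (fun _ => norm_nonneg _) hCb hbs
  have hRCb : ∀ j, R j * ‖Ring.inverse (T a) * T (ψ j)‖ ≤ R j * b j := fun j =>
    mul_le_mul_of_nonneg_left (hCb j) (zero_le_one.trans (hR1 j))
  have hRC : Summable fun j => R j * ‖Ring.inverse (T a) * T (ψ j)‖ :=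
    Summable.of_nonneg_of_le
      (fun j => mul_nonneg (zero_le_one.trans (hR1 j)) (norm_nonneg _)) hRCb hRb
  obtain ⟨N, hN⟩ := HasMonomialExpansion.neumann hR1 hRC
    ((hRC.tsum_le_tsum hRCb hRb).trans_lt hRb1) (Ring.inverse (T a) F)
  refine ⟨R, _, hR, hRs, (hN.clm_apply hR1 (e.symm : H →L[ℝ] H10 D)).congr
    (F' := fun y => forwardMap f (coeff a ψ y)) fun y hy => by
      rw [forwardMap_eq hT hF (hu y hy), inverse_coeff_eq_tsum hTu hψ hy (hu y hy) hC
        ((hC.tsum_le_tsum hCb hbs).trans_lt hb1)]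
      rfl⟩

end Posterior

end EllipticInverse

end

open EllipticInverse in
theorem proposition5p5
    {ι : Type*} [Countable ι]
    {d : ℕ} (hd : 1 ≤ d)
    (D : Set (EuclideanSpace ℝ (Fin d))) (hDopen : IsOpen D) (hDbdd : Bornology.IsBounded D)
    (f : EllipticInverse.H10 D →L[ℝ] ℝ)
    {K : ℕ} (o : Fin K → (EllipticInverse.H10 D →L[ℝ] ℝ))
    (Γ : Matrix (Fin K) (Fin K) ℝ) (hΓ : Γ.PosDef) (δ : Fin K → ℝ)
    (a : EllipticInverse.Linfty D) (ψ : ι → EllipticInverse.Linfty D)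
    -- uniform ellipticity
    (amin amax : ℝ) (hamin : 0 < amin)
    (hell : ∀ y ∈ EllipticInverse.paramDomain ι, ∀ᵐ x ∂(EllipticInverse.dom D),
      amin ≤ EllipticInverse.coeff a ψ y x ∧ EllipticInverse.coeff a ψ y x ≤ amax)
    -- control of the fluctuations relative to the mean field
    (κ abarmin : ℝ) (hκ : 0 < κ) (habarmin : 0 < abarmin)
    (ha : ∀ᵐ x ∂(EllipticInverse.dom D), abarmin ≤ a x)
    (hψ : Summable fun j => ‖ψ j‖) (hψκ : ∑' j, ‖ψ j‖ ≤ κ / (1 + κ) * abarmin)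
    -- decay of the fluctuations
    (σ : ℝ) (hσ0 : 0 < σ) (hσ1 : σ < 1) (hψσ : Summable fun j => ‖ψ j‖ ^ σ) :
    -- the forward problem is well posed, so that `Θ` is well defined on `U`
    (∀ y ∈ EllipticInverse.paramDomain ι,
      ∃! p, EllipticInverse.IsWeakSolution f (EllipticInverse.coeff a ψ y) p) ∧
    -- the derivatives of `Θ` at `0` exist
    EllipticInverse.SmoothAtZero (EllipticInverse.posteriorDensity f o Γ δ a ψ) ∧
    -- the Taylor coefficients form an `ℓ^σ` sequence
    Memℓp (EllipticInverse.taylorCoeff (EllipticInverse.posteriorDensity f o Γ δ a ψ))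
      (ENNReal.ofReal σ) := by
  obtain ⟨S, hS, e, T, hT, hTn, hTc⟩ := exists_energySpace hd hDbdd
  -- Riesz representative of `f`, transported to the energy space.
  set F : S := (InnerProductSpace.toDual ℝ S).symm (f.comp (e.symm : S →L[ℝ] H10 D)) with hFdef
  have hF : ∀ q, inner ℝ F (e q) = f q := fun q => by simp [hFdef]
  -- Uniform ellipticity gives invertibility on the whole cube; the lower bound `abarmin` of the
  -- mean field governs the Neumann series.
  have hu : ∀ y ∈ paramDomain ι, IsUnit (T (coeff a ψ y)) := fun y hy =>
    isUnit_of_coercive hamin (hTc _ _ ((hell y hy).mono fun x hx => hx.1))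
  have hTa : IsUnit (T a) := isUnit_of_coercive habarmin (hTc _ _ ha)
  refine ⟨fun y hy => ⟨_, (isWeakSolution_iff_eq hT hF (hu y hy)).2 rfl,
    fun p hp => (isWeakSolution_iff_eq hT hF (hu y hy)).1 hp⟩,
    smoothAtZero_posteriorDensity (contDiffAt_forwardMap hT hF hTa) ψ o Γ δ, ?_⟩
  -- The factor `κ / (1 + κ) < 1` provides the strict gap from which the weights are built.
  have hψc : ∑' j, ‖ψ j‖ < abarmin := by
    refine hψκ.trans_lt (mul_lt_of_lt_one_left habarmin ?_)
    rw [div_lt_one (by positivity)]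
    linarith
  obtain ⟨R, N, hR, hRs, hN⟩ := exists_weights_hasMonomialExpansion_forwardMap hT hTn hF habarmin
    (hTc _ _ ha) hu hψ hψc hσ0 hσ1 hψσ
  obtain ⟨M, hM⟩ := hN.posteriorDensity (fun j => (hR j).le) o Γ δ
  have hσr : (ENNReal.ofReal σ).toReal = σ := ENNReal.toReal_ofReal hσ0.le
  rw [memℓp_gen_iff (by rwa [hσr]), hσr]
  exact summable_rpow_of_weighted hR hσ0 hσ1 hRs hM.summable_taylorCoeff
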